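/- **Conventions.** A square path of size $N$ is a lattice path from $(0,0)$ to $(N,N)$ with unit north and east steps, ending with an east step (for $N=0$: the empty path). Its area word is $a_1,\dots,a_N$, where the $i$-th north step starts on the line $y=x+a_i$. Its shift $s$ is the largest $s$ such that the path meets the line $y=x-s$; this line is the bottom diagonal. A Dyck path is a square path of shift $0$. A partial labelling is a word $w\in\mathbb N^N$ (with $0\in\mathbb N$) such that $w_i>w_{i-1}$ whenever $a_i>a_{i-1}$, such that $w_1>0$ if $a_1=0$, and such that (for $N>0$) some $i$ has $a_i=-s$ and $w_i>0$. An index $i$ is a contractible valley if either $i=1$ and ($a_1<-1$, or $a_1=-1$ and $w_1>0$), or $i>1$ and ($a_i<a_{i-1}$, or $a_i=a_{i-1}$ and $w_i>w_{i-1}$). A valley-decorated path $\pi=(\pi,w,dv)$ is a partially labelled square path with a set $dv$ of contractible valleys. Put $\mathsf{area}(\pi)=\sum_{i}(a_i+s)$, $x^\pi=\prod_i x_{w_i}\big|_{x_0=1}$, and $$\mathsf{dinv}(\pi)=\#\{i<j : (i,j)\text{ inversion},\ i\notin dv\}+\#\{i : a_i<0,\ w_i>0\}-\#dv,$$ where $(i,j)$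 with $i<j$ is an inversion if $a_i=a_j$ and $w_i<w_j$, or $a_i=a_j+1$ and $w_i>w_j$. Let $[j]_q=\frac{1-q^j}{1-q}$. For integers $m,n,k,r\ge 0$, let $\mathsf{LSQ}'(m,n\backslash r)^{\bullet k}$ be the set of valley-decorated partially labelled square paths of size $m+n$ with exactly $n$ positive labels (hence $m$ labels equal to $0$), with $\#dv=k$, with at least one undecorated positive label on the bottom diagonal, and with $\#\{i\notin dv : a_i=-s,\ w_i>0\}=r$. Let $\mathsf{LD}(m,n\backslash r)^{\bullet k}$ be the set of valley-decorated partially labelled Dyck paths of size $m+n$ with exactly $n$ positive labels, with $\#dv=k$ and $\#\{i\notin dv : a_i=0,\ w_i>0\}=r$. **Corollary.** For all integers $m,n,k\ge 0$ and $r\ge 1$, as power series in $x_1,x_2,\dots$ over $\mathbb Q(q,t)$, $$\sum_{\pi\in \mathsf{LSQ}'(m,n\backslash r)^{\bullet k}} q^{\mathsf{dinv}(\pi)}t^{\mathsf{area}(\pi)}x^\pi=\frac{[n-k]_q}{[r]_q}\sum_{\pi\in \mathsf{LD}(m,n\backslash r)^{\bullet k}} q^{\mathsf{dinv}(\pi)}t^{\mathsf{area}(\pi)}x^\pi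 .$$ -/

import Mathlib

namespace SquarePaths

/-- A unit step of a lattice path. -/
inductive Step where
  | north
  | east
  deriving DecidableEq

/-- A square path of size `N`: a word in north and east unit steps which leads from `(0,0)` to
`(N,N)` and does not end with a north step (the empty word is the path of size `0`). -/
@[ext]
structure SquarePath (N : ℕ) where
  word : List Step
  count_north : word.count Step.north = N
  count_east : word.count Step.east = N
  ends_east : word.getLast? ≠ some Step.north

/-- The list of all `d` such that a north step of the word starts on the line `y = x + d`, in the
order of the path, when the path itself starts on the line `y = x + d₀`. -/
def northDiagonals : ℤ → List Step → List ℤ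
  | _, [] => []
  | d, Step.north :: p => d :: northDiagonals (d + 1) p
  | d, Step.east :: p => northDiagonals (d - 1) p

theorem length_northDiagonals (p : List Step) (d : ℤ) :
    (northDiagonals d p).length = p.count Step.north := by
  induction p generalizing d with
  | nil => rfl
  | cons s p ih => cases s <;> simp [northDiagonals, ih]

namespace SquarePath

variable {N : ℕ}

/-- The area word: row `i` (counted from `0`) contains the north step that starts on the line
`y = x + π.a i`. -/
def a (π : SquarePath N) (i : Fin N) : ℤ :=
  (northDiagonals 0 π.word)[i.val]'(by
    rw [length_northDiagonals, π.count_north]; exact i.isLt)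

/-- The shift: the largest `s` such that the path meets the line `y = x - s`, i.e. the maximum of
`x - y` over the lattice points `(x, y)` of the path. The subtraction may be truncated, since
`x - y = 0` at the starting point. -/
def shift (π : SquarePath N) : ℕ :=
  (Finset.range (π.word.length + 1)).sup fun l =>
    (π.word.take l).count Step.east - (π.word.take l).count Step.north

end SquarePath

/-- A partially labelled square path of size `N`; the label of row `i` is `label i`. -/
@[ext]
structure LabelledSquarePath (N : ℕ) extends SquarePath N where
  label : Fin N → ℕ
  /-- Labels increase strictly from bottom to top in each column. -/
  column_strict : ∀ i j : Fin N, i.val + 1 = j.val →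
    toSquarePath.a i < toSquarePath.a j → label i < label j
  /-- If the path starts with a north step, the first label is positive. -/
  first_pos : ∀ i : Fin N, i.val = 0 → toSquarePath.a i = 0 → 0 < label i
  /-- A nonempty path has a positive label on the bottom diagonal. -/
  bottom_pos : 0 < N → ∃ i : Fin N,
    toSquarePath.a i = -(toSquarePath.shift : ℤ) ∧ 0 < label i

/-- Row `i` is a contractible valley: a north step preceded by an east step, such that exchanging
the two gives again a validly labelled path; a first row labelled `0` has to be preceded by at
least two east steps. -/
def LabelledSquarePath.IsContractibleValley {N : ℕ} (π : LabelledSquarePath N) (i : Fin N) :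
    Prop :=
  (i.val = 0 ∧ (π.a i < -1 ∨ (π.a i = -1 ∧ 0 < π.label i))) ∨
  ∃ j : Fin N, j.val + 1 = i.val ∧
    (π.a i < π.a j ∨ (π.a i = π.a j ∧ π.label j < π.label i))

/-- A valley-decorated partially labelled square path of size `N`. -/
@[ext]
structure DecoratedPath (N : ℕ) extends LabelledSquarePath N where
  dv : Finset (Fin N)
  dv_valley : ∀ i ∈ dv, toLabelledSquarePath.IsContractibleValley i

namespace DecoratedPath

variable {N : ℕ}

/-- The area: the number of whole squares between the path and the bottom diagonal. -/
def area (π : DecoratedPath N) : ℤ := ∑ i, (π.a i + (π.shift : ℤ))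

/-- The pair of rows `(i, j)` is a (primary or secondary) inversion. -/
def IsInversion (π : DecoratedPath N) (i j : Fin N) : Prop :=
  i < j ∧ ((π.a i = π.a j ∧ π.label i < π.label j) ∨
    (π.a i = π.a j + 1 ∧ π.label j < π.label i))

open Classical in
/-- The dinv: inversions whose first row is not decorated, plus positive labels below the main
diagonal, minus decorations. -/
noncomputable def dinv (π : DecoratedPath N) : ℤ :=
  ((Finset.univ.filter fun p : Fin N × Fin N =>
      π.IsInversion p.1 p.2 ∧ p.1 ∉ π.dv).card : ℤ)
  + ((Finset.univ.filter fun i : Fin N => π.a i < 0 ∧ 0 < π.label i).card : ℤ)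
  - (π.dv.card : ℤ)

/-- The exponent of the monomial `x^π = ∏ x_{w_i}` with `x_0 = 1`: each positive label `c`
contributes one factor `x_c`. -/
noncomputable def exponent (π : DecoratedPath N) : ℕ →₀ ℕ :=
  ∑ i ∈ Finset.univ.filter (fun i : Fin N => 0 < π.label i), Finsupp.single (π.label i) 1

/-- The number of rows on the bottom diagonal whose label is positive and undecorated. -/
def bottomCount (π : DecoratedPath N) : ℕ :=
  (Finset.univ.filter fun i : Fin N =>
    i ∉ π.dv ∧ π.a i = -(π.shift : ℤ) ∧ 0 < π.label i).card

end DecoratedPath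

/-- `LSQ(m,n)^{•k}`: paths of size `m + n` with `n` positive labels (hence `m` labels `0`) and `k`
decorated contractible valleys. -/
def LSQ (m n k : ℕ) : Set (DecoratedPath (m + n)) :=
  {π | (Finset.univ.filter fun i => 0 < π.label i).card = n ∧ π.dv.card = k}

/-- `LD(m,n)^{•k}`: the Dyck paths in `LSQ(m,n)^{•k}`. -/
def LD (m n k : ℕ) : Set (DecoratedPath (m + n)) :=
  {π | π ∈ LSQ m n k ∧ π.shift = 0}

/-- `LSQ'(m,n)^{•k}`: some positive label on the bottom diagonal is not decorated. -/
def LSQ' (m n k : ℕ) : Set (DecoratedPath (m + n)) :=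
  {π | π ∈ LSQ m n k ∧ ∃ i, π.a i = -(π.shift : ℤ) ∧ i ∉ π.dv ∧ 0 < π.label i}

/-- `LSQ'(m,n∖r)^{•k}`. -/
def LSQ'Touching (m n k r : ℕ) : Set (DecoratedPath (m + n)) :=
  {π | π ∈ LSQ' m n k ∧ π.bottomCount = r}

/-- `LD(m,n∖r)^{•k}`. -/
def LDTouching (m n k r : ℕ) : Set (DecoratedPath (m + n)) :=
  {π | π ∈ LD m n k ∧ π.bottomCount = r}

theorem finite_squarePath (N : ℕ) : Finite (SquarePath N) := by
  have hlen : ∀ p : List Step,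
      p.length = p.count Step.north + p.count Step.east := by
    intro p
    induction p with
    | nil => rfl
    | cons s p ih => cases s <;> simp [ih] <;> omega
  have : Finite Step :=
    Finite.of_injective (fun s : Step => decide (s = Step.north)) (by
      intro a b h; cases a <;> cases b <;> simp_all)
  have hfin : {p : List Step | p.length = N + N}.Finite := List.finite_length_eq Step (N + N)
  have := hfin.to_subtype
  refine Finite.of_injective
    (fun π : SquarePath N => (⟨π.word, by
      simp [hlen, π.count_north, π.count_east]⟩ : {p : List Step | p.length = N + N})) ?_
  intro π σ h
  exact SquarePath.ext (congrArg Subtype.val h)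

/-- Each monomial occurs for finitely many paths of a given size only. -/
theorem finite_exponent_eq (N : ℕ) (μ : ℕ →₀ ℕ) :
    {π : DecoratedPath N | π.exponent = μ}.Finite := by
  have hS := finite_squarePath N
  have hlab : ∀ π : DecoratedPath N, π.exponent = μ → ∀ i, π.label i < μ.support.sup id + 1 := by
    intro π hπ i
    rcases Nat.eq_zero_or_pos (π.label i) with h | h
    · omega
    · have : π.label i ∈ μ.support := by
        rw [← hπ, Finsupp.mem_support_iff, DecoratedPath.exponent, Finsupp.finsetSum_apply]
        refine (Finset.sum_pos' (fun _ _ => Nat.zero_le _)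
          ⟨i, by simp [h], by simp⟩).ne'
      exact Nat.lt_succ_of_le (Finset.le_sup (f := id) this)
  let f : {π : DecoratedPath N | π.exponent = μ} →
      SquarePath N × (Fin N → Fin (μ.support.sup id + 1)) × Finset (Fin N) :=
    fun π => (π.1.toSquarePath, fun i => ⟨π.1.label i, hlab π.1 π.2 i⟩, π.1.dv)
  have hf : Function.Injective f := by
    rintro ⟨π, hπ⟩ ⟨σ, hσ⟩ h
    simp only [f, Prod.mk.injEq] at h
    obtain ⟨h1, h2, h3⟩ := h
    have h2' : π.label = σ.label := funext fun i => congrArg Fin.val (congrFun h2 i)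
    refine Subtype.ext (DecoratedPath.ext ?_ h2' h3)
    exact congrArg SquarePath.word h1
  exact Set.finite_coe_iff.mp (Finite.of_injective f hf)

/-- The field `ℚ(q,t)`. -/
abbrev QT : Type := FractionRing (MvPolynomial (Fin 2) ℚ)

/-- The indeterminate `q`. -/
noncomputable def q : QT := algebraMap (MvPolynomial (Fin 2) ℚ) QT (MvPolynomial.X 0)

/-- The indeterminate `t`. -/
noncomputable def t : QT := algebraMap (MvPolynomial (Fin 2) ℚ) QT (MvPolynomial.X 1)

/-- The `q`-integer `[j]_q`. -/
noncomputable def qInt (j : ℤ) : QT := (1 - q ^ j) / (1 - q)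

open Classical in
/-- The `q,t;x`-enumerator `∑_{π ∈ S} q^{dinv π} t^{area π} x^π` of a set of decorated paths of
size `N`, as a power series in `x_1, x_2, …` over `ℚ(q,t)`, given by its coefficients. (The
variable of index `0` does not occur.) -/
noncomputable def enumerator {N : ℕ} (S : Set (DecoratedPath N)) : MvPowerSeries ℕ QT := fun μ =>
  ∑ π ∈ (finite_exponent_eq N μ).toFinset.filter (fun π => π ∈ S), q ^ π.dinv * t ^ π.area

end SquarePaths

/-! Read each row of a path as a letter: its level above the bottom diagonal, its label and its
decoration. The multiset of letters (`content`) determines area, monomial and the numbers `n`, `k`,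
`r`, so the identity can be proved for one content at a time. Order values by increasing level, then
decreasing label, and let `τ` raise the level by one. Column strictness and contractibility both
become `inner τ y < τ x.1` for consecutive letters `x`, `y`, and the conditions at the two ends of a
path of shift `s` become comparisons with the value `θ = (s, 0)` (`admissible_letter`,
`exists_letter_eq`). For fixed content the shift thus enters only through the two bounds `θ` and the
bonus term of dinv.

The core is `exists_invEnum`: the inversion enumerator with both bounds `θ` is an explicit `q ^ a *
(1 - q ^ b)` times a factor `κ` that does not depend on `θ`. It is proved by stripping letters.
Decorated letters split off as elementary symmetric polynomials in powers of `q`, extremal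
undecorated letters as complete homogeneous ones. Stripping the largest letter handles small `θ`,
stripping the smallest handles large `θ`, and the two answers are matched.

With the remaining dinv terms included, shift `s` contributes `(q ^ balance c s - q ^ balance c (s +
1)) * κ` (`exists_telescope`). The balance is `0` at `s = 0`, `r` at `s = 1` and `n - k` for large
`s`. All shifts together give `(1 - q ^ (n - k)) * κ` and the Dyck paths, `s = 0`, give `(1 - q ^ r)
* κ`. -/

namespace SquarePaths

/-! ### Symmetric polynomials at powers of `q`. -/

section QCounting

variable {K : Type*} [Field K]

/-- The complete homogeneous symmetric polynomial of degree `m` at `1, q, …, q ^ (h - 1)`. -/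
def hcomp (q : K) : ℕ → ℕ → K
  | _, 0 => 1
  | 0, _ + 1 => 0
  | h + 1, m + 1 => hcomp q h (m + 1) + q ^ h * hcomp q (h + 1) m

/-- The elementary symmetric polynomial of degree `m` at `1, q, …, q ^ (h - 1)`. -/
def elem (q : K) : ℕ → ℕ → K
  | _, 0 => 1
  | 0, _ + 1 => 0
  | h + 1, m + 1 => q ^ (m + 1) * elem q h (m + 1) + q ^ m * elem q h m

@[simp] theorem hcomp_zero_right (q : K) (h : ℕ) : hcomp q h 0 = 1 := by rw [hcomp]

@[simp] theorem hcomp_zero_succ (q : K) (m : ℕ) : hcomp q 0 (m + 1) = 0 := by rw [hcomp]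

theorem hcomp_succ_succ (q : K) (h m : ℕ) :
    hcomp q (h + 1) (m + 1) = hcomp q h (m + 1) + q ^ h * hcomp q (h + 1) m := by
  rw [hcomp]

@[simp] theorem elem_zero_right (q : K) (h : ℕ) : elem q h 0 = 1 := by cases h <;> rfl

@[simp] theorem elem_zero_succ (q : K) (m : ℕ) : elem q 0 (m + 1) = 0 := rfl

theorem elem_succ_succ (q : K) (h m : ℕ) :
    elem q (h + 1) (m + 1) = q ^ (m + 1) * elem q h (m + 1) + q ^ m * elem q h m := by
  rw [elem]

theorem hcomp_one (q : K) (m : ℕ) : hcomp q 1 m = 1 := by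
  induction m with
  | zero => simp
  | succ m ih => simp [hcomp_succ_succ q 0, ih]

/-- Splits off the variable `1` instead of `q ^ h`; the other variables are `q` times the first `h`,
hence the power of `q`. This form serves the smallest letter, `hcomp_succ_succ` the largest. -/
theorem hcomp_succ_succ' (q : K) (h m : ℕ) :
    hcomp q (h + 1) (m + 1) = q ^ (m + 1) * hcomp q h (m + 1) + hcomp q (h + 1) m := by
  induction h generalizing m with
  | zero => simp [hcomp_succ_succ q 0]
  | succ h ih =>
    induction m with
    | zero =>
      have h1 := hcomp_succ_succ q (h + 1) 0
      have h2 := hcomp_succ_succ q h 0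
      have h3 := ih 0
      simp only [hcomp_zero_right, zero_add, pow_one, mul_one] at h1 h2 h3 ⊢
      rw [pow_succ] at h1
      linear_combination h1 + h3 - q * h2
    | succ m ihm =>
      have h1 := hcomp_succ_succ q (h + 1) (m + 1)
      have h2 := hcomp_succ_succ q h (m + 1)
      have h3 := hcomp_succ_succ q (h + 1) m
      have h4 := ih (m + 1)
      rw [pow_succ] at h1 h3 h4 ⊢
      linear_combination h1 + h4 + q ^ h * q * ihm - q ^ (m + 1) * q * h2 - h3

theorem elem_succ_succ' (q : K) (h m : ℕ) :
    elem q (h + 1) (m + 1) = elem q h (m + 1) + q ^ h * elem q h m := by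
  induction h generalizing m with
  | zero => cases m <;> simp [elem_succ_succ q 0]
  | succ h ih =>
    cases m with
    | zero =>
      have h1 := elem_succ_succ q (h + 1) 0
      have h2 := elem_succ_succ q h 0
      have h3 := ih 0
      simp only [elem_zero_right, zero_add, pow_one, pow_zero, mul_one] at h1 h2 h3 ⊢
      rw [pow_succ]
      linear_combination h1 + q * h3 - h2
    | succ m =>
      have h1 := elem_succ_succ q (h + 1) (m + 1)
      have h2 := elem_succ_succ q h (m + 1)
      have h3 := elem_succ_succ q h m
      have h4 := ih (m + 1)
      have h5 := ih m
      rw [pow_succ] at h1 h2 ⊢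
      linear_combination h1 + q ^ (m + 1) * q * h4 + q ^ (m + 1) * h5 - h2 - q ^ h * q * h3

/-- Elimination between the two recursions; it absorbs a stripping factor into the prefactor `1 - q
^ card`. -/
theorem one_sub_pow_mul_hcomp (q : K) (h m : ℕ) :
    (1 - q ^ h) * hcomp q (h + 1) m = (1 - q ^ (h + m)) * hcomp q h m := by
  cases m with
  | zero => simp
  | succ m =>
    have h1 := hcomp_succ_succ q h m
    have h2 := hcomp_succ_succ' q h m
    rw [pow_add]
    linear_combination h1 - q ^ h * h2

/-- The elementary counterpart. The exponent is an integer because `m` may exceed `h + 1`. -/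
theorem one_sub_pow_mul_elem {q : K} (hq : q ≠ 0) (h m : ℕ) :
    (1 - q ^ (h + 1)) * elem q h m = (1 - q ^ (((h + 1 : ℕ) : ℤ) - m)) * elem q (h + 1) m := by
  cases m with
  | zero => simp [← zpow_natCast]
  | succ m =>
    have h1 := elem_succ_succ q h m
    have h2 := elem_succ_succ' q h m
    have h3 : q ^ (((h + 1 : ℕ) : ℤ) - ((m + 1 : ℕ) : ℤ)) * q ^ m = q ^ h := by
      rw [← zpow_natCast, ← zpow_natCast, ← zpow_add₀ hq]
      congr 1
      push_cast
      ring
    set z := q ^ (((h + 1 : ℕ) : ℤ) - ((m + 1 : ℕ) : ℤ))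
    rw [pow_succ] at h1 ⊢
    linear_combination z * h1 - h2 + (elem q h m + q * elem q h (m + 1)) * h3

end QCounting

/-! ### Arrangements of a multiset, split by their first letter. -/

section Arrangements

variable {α K : Type*} [DecidableEq α] [AddCommMonoid K]

/-- The finite set of all arrangements of a multiset as a list. -/
def arrangements (c : Multiset α) : Finset (List α) := c.lists.toFinset

theorem mem_arrangements {c : Multiset α} {w : List α} :
    w ∈ arrangements c ↔ (w : Multiset α) = c := by
  rw [arrangements, Multiset.mem_toFinset, Multiset.mem_lists_iff, eq_comm]
  rfl

theorem arrangements_zero : arrangements (0 : Multiset α) = {[]} := by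
  ext w
  simp [mem_arrangements]

theorem sum_arrangements (F : List α → K) {c : Multiset α} (hc : c ≠ 0) :
    ∑ w ∈ arrangements c, F w =
      ∑ x ∈ c.toFinset, ∑ w ∈ arrangements (c.erase x), F (x :: w) := by
  rw [Finset.sum_sigma']
  symm
  refine Finset.sum_bij (fun p _ => p.1 :: p.2) ?_ ?_ ?_ ?_
  · rintro ⟨x, w⟩ h
    simp only [Finset.mem_sigma, Multiset.mem_toFinset, mem_arrangements] at h ⊢
    rw [← Multiset.cons_coe, h.2, Multiset.cons_erase h.1]
  · rintro ⟨x, w⟩ _ ⟨y, v⟩ _ h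
    simp only [List.cons.injEq] at h
    obtain ⟨rfl, rfl⟩ := h
    rfl
  · intro w hw
    rw [mem_arrangements] at hw
    cases w with
    | nil => exact absurd hw.symm hc
    | cons x w =>
      refine ⟨⟨x, w⟩, ?_, rfl⟩
      subst hw
      simp [mem_arrangements]
  · intro _ _
    rfl

end Arrangements

theorem countP_replicate {α : Type*} (p : α → Prop) [DecidablePred p] (m : ℕ) (x : α) :
    (Multiset.replicate m x).countP p = if p x then m else 0 := by
  induction m with
  | zero => simp
  | succ m ih => rw [Multiset.replicate_succ, Multiset.countP_cons, ih]; split_ifs <;> rfl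

/-- The value which a letter shows to its predecessor: that of an undecorated letter itself, and
that of a decorated letter moved up by one level. -/
def inner {T : Type*} (τ : T → T) (x : T × Bool) : T := if x.2 then τ x.1 else x.1

@[simp] theorem inner_false {T : Type*} (τ : T → T) (v : T) : inner τ (v, false) = v := rfl

@[simp] theorem inner_true {T : Type*} (τ : T → T) (v : T) : inner τ (v, true) = τ v := rfl

theorem inner_of_eq_false {T : Type*} (τ : T → T) {x : T × Bool} (h : x.2 = false) :
    inner τ x = x.1 := by
  simp [inner, h]

/-! ### Admissible words and their inversion enumerator. -/

section Words

variable {T K : Type*} [LinearOrder T] [Field K]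

/-- The word `w` is admissible between the bounds `o` (before the word) and `e` (after it). -/
def Admissible (τ : T → T) (e : T) : T → List (T × Bool) → Prop
  | o, [] => e < o
  | o, x :: w => inner τ x < o ∧ Admissible τ e (τ x.1) w

/-- The number of inversions from a letter to the letters of a multiset to its right. -/
def invFrom (τ : T → T) (x : T × Bool) (c : Multiset (T × Bool)) : ℕ :=
  if x.2 then 0 else c.countP fun u => u.1 < x.1 ∧ x.1 < τ u.1

/-- The number of inversions of a word. -/
def inversions (τ : T → T) : List (T × Bool) → ℕ
  | [] => 0
  | x :: w => invFrom τ x w + inversions τ w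

/-- The number of undecorated letters `u` with `u < y < τ u`. -/
def crossings (τ : T → T) (y : T) (c : Multiset (T × Bool)) : ℕ :=
  c.countP fun u => u.2 = false ∧ u.1 < y ∧ y < τ u.1

open Classical in
/-- The inversion enumerator of the admissible arrangements of a multiset of letters. -/
noncomputable def invEnum (τ : T → T) (q : K) (e o : T) (c : Multiset (T × Bool)) : K :=
  ∑ w ∈ arrangements c, if Admissible τ e o w then q ^ inversions τ w else 0

variable {τ : T → T} {q : K}

theorem invEnum_zero (e o : T) : invEnum τ q e o 0 = if e < o then 1 else 0 := by
  simp [invEnum, arrangements_zero, Admissible, inversions]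

theorem invEnum_rec (e o : T) {c : Multiset (T × Bool)} (hc : c ≠ 0) :
    invEnum τ q e o c = ∑ x ∈ c.toFinset, if inner τ x < o then
      q ^ invFrom τ x (c.erase x) * invEnum τ q e (τ x.1) (c.erase x) else 0 := by
  rw [invEnum, sum_arrangements _ hc]
  refine Finset.sum_congr rfl fun x _ => ?_
  split_ifs with h
  · rw [invEnum, Finset.mul_sum]
    refine Finset.sum_congr rfl fun w hw => ?_
    rw [mem_arrangements] at hw
    have h' : Admissible τ e o (x :: w) ↔ Admissible τ e (τ x.1) w := by simp [Admissible, h]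
    simp only [inversions, hw, pow_add, mul_ite, mul_zero]
    by_cases h2 : Admissible τ e (τ x.1) w
    · rw [if_pos h2, if_pos (h'.mpr h2)]
    · rw [if_neg h2, if_neg fun h3 => h2 (h'.mp h3)]
  · refine Finset.sum_eq_zero fun w _ => ?_
    simp [Admissible, h]

theorem Admissible.congr_bound {e e' : T} {w : List (T × Bool)} (o : T) (hw : w ≠ [])
    (he : ∀ x ∈ w, e < τ x.1 ∧ e' < τ x.1) :
    Admissible τ e o w ↔ Admissible τ e' o w := by
  induction w generalizing o with
  | nil => exact absurd rfl hw
  | cons x w ih =>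
    refine and_congr_right fun _ => ?_
    cases w with
    | nil => simpa [Admissible] using iff_of_true (he x (by simp)).1 (he x (by simp)).2
    | cons y w => exact ih _ (by simp) fun z hz => he z (List.mem_cons_of_mem _ hz)

theorem invEnum_congr_left {e e' : T} (o : T) {c : Multiset (T × Bool)} (hc : c ≠ 0)
    (he : ∀ x ∈ c, e < τ x.1 ∧ e' < τ x.1) : invEnum τ q e o c = invEnum τ q e' o c := by
  refine Finset.sum_congr rfl fun w hw => ?_
  rw [mem_arrangements] at hw
  subst hw
  rw [Admissible.congr_bound o (by simpa using hc) (by simpa using he)]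

theorem invEnum_congr_right (e : T) {o o' : T} {c : Multiset (T × Bool)} (hc : c ≠ 0)
    (ho : ∀ x ∈ c, inner τ x < o ∧ inner τ x < o') :
    invEnum τ q e o c = invEnum τ q e o' c := by
  rw [invEnum_rec e o hc, invEnum_rec e o' hc]
  refine Finset.sum_congr rfl fun x hx => ?_
  have := ho x (by simpa using hx)
  rw [if_pos this.1, if_pos this.2]

/-- The word starts at or below `y` and its last bound has to exceed `e`, so some letter climbs past
`y`. A decorated letter cannot be the first to do so, since `τ x.1` itself lies below the preceding
bound. -/
theorem Admissible.crossings_pos {e y : T} (hey : y ≤ e) {w : List (T × Bool)} {o : T}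
    (hoy : o ≤ y) (h : Admissible τ e o w) : 0 < crossings τ y w := by
  induction w generalizing o with
  | nil => exact absurd (h.trans_le (hoy.trans hey)) (lt_irrefl _)
  | cons x w ih =>
    obtain ⟨h1, h2⟩ := h
    rw [crossings, ← Multiset.cons_coe]
    rcases le_or_gt (τ x.1) y with h3 | h3
    · exact (ih h3 h2).trans_le (Multiset.countP_le_of_le _ (Multiset.le_cons_self _ _))
    · have hx : x.2 = false ∧ x.1 < y ∧ y < τ x.1 := by
        have h4 := h1.trans_le hoy
        rcases hx : x.2 with _ | _
        · exact ⟨rfl, by simpa [inner, hx] using h4, h3⟩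
        · simp only [inner, hx, if_true] at h4
          exact absurd h4 h3.not_gt
      exact Multiset.countP_pos.mpr ⟨x, Multiset.mem_cons_self _ _, hx⟩

theorem invEnum_eq_zero {e o y : T} (hey : y ≤ e) (hoy : o ≤ y) {c : Multiset (T × Bool)}
    (hc : crossings τ y c = 0) : invEnum τ q e o c = 0 := by
  refine Finset.sum_eq_zero fun w hw => if_neg fun h => ?_
  rw [mem_arrangements] at hw
  have := h.crossings_pos hey hoy
  rw [hw] at this
  omega

/-- The recursion for a multiset which contains a given letter `m + 1` times. -/
theorem invEnum_add_replicate (e o : T) {c : Multiset (T × Bool)} {X : T × Bool} (hX : X ∉ c)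
    (m : ℕ) :
    invEnum τ q e o (c + Multiset.replicate (m + 1) X) =
      (∑ x ∈ c.toFinset, if inner τ x < o then
        q ^ invFrom τ x (c.erase x + Multiset.replicate (m + 1) X) *
          invEnum τ q e (τ x.1) (c.erase x + Multiset.replicate (m + 1) X) else 0) +
      if inner τ X < o then q ^ invFrom τ X (c + Multiset.replicate m X) *
        invEnum τ q e (τ X.1) (c + Multiset.replicate m X) else 0 := by
  have h0 : c + Multiset.replicate (m + 1) X ≠ 0 := by
    intro h
    have := congrArg Multiset.card h
    simp at this
  have hs : (c + Multiset.replicate (m + 1) X).toFinset = insert X c.toFinset := by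
    ext x
    rw [Multiset.mem_toFinset, Multiset.mem_add, Multiset.mem_replicate, Finset.mem_insert,
      Multiset.mem_toFinset]
    simp [or_comm]
  have he : (c + Multiset.replicate (m + 1) X).erase X = c + Multiset.replicate m X := by
    rw [Multiset.erase_add_right_neg _ hX, Multiset.replicate_succ, Multiset.erase_cons_head]
  rw [invEnum_rec e o h0, hs, Finset.sum_insert (by simpa using hX), he, add_comm]
  congr 1
  refine Finset.sum_congr rfl fun x hx => ?_
  rw [Multiset.erase_add_left_pos _ (by simpa using hx)]

theorem crossings_add (y : T) (c d : Multiset (T × Bool)) :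
    crossings τ y (c + d) = crossings τ y c + crossings τ y d :=
  Multiset.countP_add _ _ _

theorem crossings_replicate (y : T) (m : ℕ) (X : T × Bool) :
    crossings τ y (Multiset.replicate m X) =
      if X.2 = false ∧ X.1 < y ∧ y < τ X.1 then m else 0 := by
  rw [crossings, countP_replicate]

theorem crossings_erase (y : T) {c : Multiset (T × Bool)} {x : T × Bool} (hx : x ∈ c) :
    crossings τ y c = crossings τ y (c.erase x) +
      if x.2 = false ∧ x.1 < y ∧ y < τ x.1 then 1 else 0 := by
  conv_lhs => rw [← Multiset.cons_erase hx]
  rw [crossings, Multiset.countP_cons]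
  rfl

theorem invFrom_add_replicate (x : T × Bool) (c : Multiset (T × Bool)) (m : ℕ) (X : T × Bool) :
    invFrom τ x (c + Multiset.replicate m X) = invFrom τ x c +
      if x.2 = false ∧ X.1 < x.1 ∧ x.1 < τ X.1 then m else 0 := by
  rcases hx : x.2 with _ | _ <;> simp [invFrom, hx, countP_replicate]

end Words

/-! ### Stripping extremal and decorated letters. -/

section Strip

variable {T K : Type*} [LinearOrder T] [Field K] {τ : T → T} {q : K}

/-- Removal of the largest letter. -/
theorem invEnum_add_max (hlt : ∀ x, x < τ x) {e X : T} (heX : e ≤ X)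
    (c : Multiset (T × Bool)) (hc : ∀ x ∈ c, x.2 = false ∧ x.1 < X) (o : T) (m : ℕ) :
    invEnum τ q e o (c + Multiset.replicate m (X, false)) =
      hcomp q (crossings τ X c + if X < o then 1 else 0) m * invEnum τ q e o c := by
  -- Copies of `X` stand right after a letter that crosses `X`, or in front if `X < o`. Each copy
  -- has inversions exactly to the crossing letters on its right, so choosing slots with repetition
  -- gives `hcomp`. The induction on the first letter carries this out.
  induction c using Multiset.strongInductionOn generalizing o m with
  | ih c IH =>
  induction m generalizing o with
  | zero => simp
  | succ m ihm =>
  have hX : (X, false) ∉ c := fun h => lt_irrefl _ (hc _ h).2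
  have h1 : ∑ x ∈ c.toFinset, (if inner τ x < o then
        q ^ invFrom τ x (c.erase x + Multiset.replicate (m + 1) (X, false)) *
          invEnum τ q e (τ x.1) (c.erase x + Multiset.replicate (m + 1) (X, false)) else 0) =
      hcomp q (crossings τ X c) (m + 1) * invEnum τ q e o c := by
    rcases eq_or_ne c 0 with rfl | hc0
    · simp [crossings]
    · rw [invEnum_rec e o hc0, Finset.mul_sum]
      refine Finset.sum_congr rfl fun x hx => ?_
      rw [Multiset.mem_toFinset] at hx
      obtain ⟨hx2, hxX⟩ := hc x hx
      split_ifs with hxo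
      · rw [IH _ (Multiset.erase_lt.mpr hx) (fun y hy => hc y (Multiset.mem_of_mem_erase hy)),
          invFrom_add_replicate, if_neg (fun h => hxX.not_gt h.2.1), crossings_erase X hx]
        simp only [hx2, hxX, true_and, add_zero]
        ring
      · rw [mul_zero]
  -- Both bounds exceed every letter of `c`, so a leading `X` can be dropped.
  have h2 : X < o → invEnum τ q e (τ X) c = invEnum τ q e o c := by
    intro ho
    rcases eq_or_ne c 0 with rfl | hc0
    · rw [invEnum_zero, invEnum_zero, if_pos (heX.trans_lt (hlt X)), if_pos (heX.trans_lt ho)]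
    · refine invEnum_congr_right e hc0 fun x hx => ?_
      obtain ⟨hx2, hxX⟩ := hc x hx
      rw [inner_of_eq_false τ hx2]
      exact ⟨hxX.trans (hlt X), hxX.trans ho⟩
  have h3 : invFrom τ (X, false) (c + Multiset.replicate m (X, false)) = crossings τ X c := by
    rw [invFrom_add_replicate, if_neg (fun h => lt_irrefl _ h.2.1), add_zero, invFrom, crossings]
    simp only [Bool.false_eq_true, if_false]
    exact Multiset.countP_congr rfl fun x hx => by simp [(hc x hx).1]
  rw [invEnum_add_replicate e o hX, h1, h3, ihm]
  simp only [inner_false]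
  by_cases ho : X < o
  · simp only [ho, hlt X, if_true]
    rw [h2 ho, hcomp_succ_succ]
    ring
  · simp [ho]

/-- Removal of the smallest letter. -/
theorem invEnum_add_min (hτ : StrictMono τ) (hlt : ∀ x, x < τ x) {e X : T}
    (c : Multiset (T × Bool)) (hc : ∀ x ∈ c, x.2 = false ∧ X < x.1) {o : T} (ho : τ X ≤ o) (m : ℕ) :
    invEnum τ q e o (c + Multiset.replicate m (X, false)) =
      hcomp q (crossings τ (τ X) c + if e < τ X then 1 else 0) m * invEnum τ q e o c := by
  -- Mirror image: copies of `X` stand right before a letter below `τ X`, or at the end if `e < τ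
  -- X`, and a copy receives inversions from the letters crossing `τ X` on its left.
  induction c using Multiset.strongInductionOn generalizing o m with
  | ih c IH =>
  induction m generalizing o with
  | zero => simp
  | succ m ihm =>
  have hX : (X, false) ∉ c := fun h => lt_irrefl _ (hc _ h).2
  have hXo : X < o := (hlt X).trans_le ho
  have h3 : invFrom τ (X, false) c = 0 := by
    simp only [invFrom, Bool.false_eq_true, if_false]
    exact Multiset.countP_eq_zero.mpr fun x hx h => h.1.not_gt (hc x hx).2
  have h4 : invFrom τ (X, false) (c + Multiset.replicate m (X, false)) = 0 := by
    rw [invFrom_add_replicate, if_neg (fun h => lt_irrefl _ h.2.1), h3]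
  rw [invEnum_add_replicate e o hX, ihm le_rfl, h4, inner_false, if_pos hXo, pow_zero, one_mul]
  rcases eq_or_ne c 0 with rfl | hc0
  · simp only [Multiset.toFinset_zero, Finset.sum_empty, zero_add, crossings, Multiset.countP_zero,
      invEnum_zero]
    by_cases h1 : e < τ X
    · simp [h1, h1.trans_le ho, hcomp_one]
    · simp [h1]
  · rw [invEnum_rec e o hc0, invEnum_rec e (τ X) hc0, Finset.mul_sum, Finset.mul_sum,
      ← Finset.sum_add_distrib]
    refine Finset.sum_congr rfl fun x hx => ?_
    rw [Multiset.mem_toFinset] at hx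
    obtain ⟨hx2, hxX⟩ := hc x hx
    rw [IH _ (Multiset.erase_lt.mpr hx) (fun y hy => hc y (Multiset.mem_of_mem_erase hy))
      (hτ hxX).le, invFrom_add_replicate, crossings_erase (τ X) hx]
    rw [inner_of_eq_false τ hx2]
    simp only [hx2, hxX, hτ hxX, true_and, and_true]
    by_cases h1 : x.1 < τ X
    · simp only [h1, h1.trans_le ho, if_true]
      rw [add_right_comm, hcomp_succ_succ', pow_add]
      ring
    · simp only [h1, if_false, mul_zero, add_zero]
      split_ifs <;> ring

/-- The factor contributed by `m` equal decorated letters which behave like `y`, in a word that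
runs from the bound `o` to the bound `e` and has `h` crossings with `y`. -/
def decFactor (q : K) (e o y : T) (h m : ℕ) : K :=
  if y < o then (if y ≤ e then elem q h m else elem q (h + 1) m)
  else q ^ m * (if y ≤ e then elem q (h - 1) m else elem q h m)

@[simp] theorem decFactor_zero (e o y : T) (h : ℕ) : decFactor q e o y h 0 = 1 := by
  simp [decFactor]

/-- Removal of a decorated letter. -/
theorem invEnum_add_decorated (hτ : StrictMono τ) (hlt : ∀ x, x < τ x) {e X : T}
    (c : Multiset (T × Bool)) (hc : (X, true) ∉ c) (o : T) (m : ℕ) :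
    invEnum τ q e o (c + Multiset.replicate m (X, true)) =
      decFactor q e o (τ X) (crossings τ (τ X) c) m * invEnum τ q e o c := by
  -- Put `y = τ X`. A decorated `X` fits exactly where the word passes down across `y`, and at most
  -- once per passage, hence `elem`. Crossings are the upward passages, so with `h` of them there
  -- are `h + [y < o] - [y ≤ e]` downward ones. A copy receives one inversion from each crossing on
  -- its left; if `o ≤ y`, a crossing precedes every slot, hence the factor `q ^ m`.
  induction c using Multiset.strongInductionOn generalizing o m with
  | ih c IH =>
  induction m generalizing o with
  | zero => simp
  | succ m ihm =>
  rw [invEnum_add_replicate e o hc, ihm]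
  have h3 (d) : invFrom τ (X, true) d = 0 := by simp [invFrom]
  simp only [h3, inner_true, pow_zero, one_mul]
  rcases eq_or_ne c 0 with rfl | hc0
  · simp only [Multiset.toFinset_zero, Finset.sum_empty, zero_add, crossings, Multiset.countP_zero,
      invEnum_zero, decFactor, lt_irrefl, if_false]
    by_cases h1 : τ X < o <;> by_cases h2 : τ X ≤ e
    · simp [h1, h2, h2.not_gt]
    · have h4 : e < τ X := not_le.mp h2
      rcases m with _ | m <;> simp [h1, h2, h4, h4.trans h1, elem_succ_succ]
    · simp [h1, h2]
    · simp [h1, h2]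
  · have key : ∀ x ∈ c, (if inner τ x < o then
          q ^ invFrom τ x (c.erase x + Multiset.replicate (m + 1) (X, true)) *
            invEnum τ q e (τ x.1) (c.erase x + Multiset.replicate (m + 1) (X, true)) else 0) +
        (if τ X < o then decFactor q e (τ X) (τ X) (crossings τ (τ X) c) m *
          (if inner τ x < τ X then
            q ^ invFrom τ x (c.erase x) * invEnum τ q e (τ x.1) (c.erase x) else 0) else 0) =
        decFactor q e o (τ X) (crossings τ (τ X) c) (m + 1) * (if inner τ x < o then
            q ^ invFrom τ x (c.erase x) * invEnum τ q e (τ x.1) (c.erase x) else 0) := by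
      intro x hx
      rw [IH _ (Multiset.erase_lt.mpr hx) (fun h => hc (Multiset.mem_of_mem_erase h)),
        invFrom_add_replicate, crossings_erase (τ X) hx]
      simp only [hτ.lt_iff_lt]
      -- Either the first letter crosses `τ X`, or it stays at or above it, or it starts below and
      -- does not get past it.
      by_cases hA : x.2 = false ∧ x.1 < τ X ∧ X < x.1
      · obtain ⟨h1, h2, h3⟩ := hA
        have h4 : τ X < τ x.1 := hτ h3
        rw [inner_of_eq_false τ h1]
        simp only [h1, h2, h3, decFactor, h4, lt_irrefl, true_and, if_true, if_false,
          pow_add, Nat.add_sub_cancel]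
        by_cases ho : τ X < o <;> by_cases ho' : x.1 < o <;> by_cases he : τ X ≤ e <;>
          simp only [ho, ho', he, if_true, if_false, elem_succ_succ]
        all_goals first
          | ring1
          | exact absurd (h2.trans ho) ho'
      · have hA' : ¬ (x.2 = false ∧ X < x.1 ∧ x.1 < τ X) := fun h => hA ⟨h.1, h.2.2, h.2.1⟩
        simp only [hA, hA', if_false, add_zero]
        by_cases h1 : X < x.1
        · have h2 : τ X < τ x.1 := hτ h1
          have h3 : τ X ≤ inner τ x := by
            rw [inner]
            split_ifs with h
            · exact h2.le
            · exact not_lt.mp fun h' => hA ⟨by simpa using h, h', h1⟩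
          simp only [h3.not_gt, decFactor, h2, if_true, if_false, mul_zero, ite_self, add_zero]
          by_cases ho : inner τ x < o
          · simp only [ho, h3.trans_lt ho, if_true]
            ring
          · simp only [ho, if_false, mul_zero]
        · have h2 : ¬ τ X < τ x.1 := fun h => h1 (hτ.lt_iff_lt.mp h)
          have h3 : inner τ x < τ X := by
            rw [inner]
            split_ifs with h
            · refine hτ (lt_of_le_of_ne (not_lt.mp h1) ?_)
              rintro h4
              exact hc (by rw [← h4, ← h]; exact hx)
            · exact (not_lt.mp h1).trans_lt (hlt X)
          simp only [h3, decFactor, h2, lt_irrefl, if_true, if_false]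
          by_cases ho : τ X < o
          · simp only [ho, h3.trans ho, if_true]
            by_cases he : τ X ≤ e
            · simp only [he, if_true]
              -- With no crossing left, the truncated `h - 1` in `decFactor` is harmless, as the
              -- remaining enumerator vanishes.
              rcases hcr : crossings τ (τ X) (c.erase x) with _ | h
              · rw [invEnum_eq_zero he (not_lt.mp h2) hcr]
                simp
              · rw [elem_succ_succ]
                simp only [Nat.add_sub_cancel]
                ring
            · simp only [he, if_false, elem_succ_succ]
              ring
          · simp only [ho, if_false, add_zero]
            split_ifs <;> ring
    rw [invEnum_rec e o hc0, invEnum_rec e (τ X) hc0, Finset.mul_sum, Finset.mul_sum,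
      ← Finset.sum_congr rfl fun x hx => key x (Multiset.mem_toFinset.mp hx),
      Finset.sum_add_distrib]
    congr 1
    split_ifs
    · rfl
    · rw [Finset.sum_const_zero]

end Strip

/-! ### Dependence of the enumerator on a common bound. -/

section Rotation

variable {T K : Type*} [LinearOrder T] [Field K] {τ : T → T} {q : K}

theorem crossings_eq_card {y : T} {c : Multiset (T × Bool)}
    (h : ∀ x ∈ c, x.2 = false ∧ x.1 < y ∧ y < τ x.1) : crossings τ y c = c.card :=
  Multiset.countP_eq_card.mpr h

theorem filter_ne_add_replicate {α : Type*} [DecidableEq α] (c : Multiset α) (x : α) :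
    c.filter (fun y => y ≠ x) + Multiset.replicate (c.count x) x = c := by
  rw [← Multiset.filter_eq', add_comm]
  exact Multiset.filter_add_not _ _

theorem filter_ne_lt {α : Type*} [DecidableEq α] {c : Multiset α} {x : α} (hx : x ∈ c) :
    c.filter (fun y => y ≠ x) < c := by
  refine lt_of_le_of_ne (Multiset.filter_le _ _) fun h => ?_
  rw [← h] at hx
  exact (Multiset.mem_filter.mp hx).2 rfl

/-- For undecorated letters, the enumerators with equal bounds `θ` depend on `θ` only through the
number of crossings; if all letters are compatible, then the enumerator without bounds fits in. -/
theorem exists_invEnum_undecorated (hτ : StrictMono τ) (hlt : ∀ x, x < τ x)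
    (hq : ∀ n : ℕ, n ≠ 0 → 1 - q ^ n ≠ 0) (c : Multiset (T × Bool)) (hc : ∀ x ∈ c, x.2 = false)
    (hc0 : c ≠ 0) :
    ∃ κ : K, (∀ θ, invEnum τ q θ θ c = (1 - q ^ crossings τ θ c) * κ) ∧
      ∀ e o, (∀ x ∈ c, e ≤ x.1 ∧ τ x.1 ≤ o) → (∀ x ∈ c, ∀ y ∈ c, x.1 < τ y.1) →
        invEnum τ q e o c = (1 - q ^ c.card) * κ := by
  induction c using Multiset.strongInductionOn with
  | ih c IH =>
  obtain ⟨⟨X, b⟩, hXc, hXmax⟩ := c.toFinset.exists_max_image Prod.fst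
    ((Multiset.toFinset_nonempty).mpr hc0)
  obtain ⟨⟨Y, b'⟩, hYc, hYmin⟩ := c.toFinset.exists_min_image Prod.fst
    ((Multiset.toFinset_nonempty).mpr hc0)
  simp only [Multiset.mem_toFinset] at hXc hXmax hYc hYmin
  obtain rfl : b = false := hc _ hXc
  obtain rfl : b' = false := hc _ hYc
  -- between the largest and the smallest letter, the bounds do not matter
  have hmid : ∀ θ, X < θ → θ < τ Y → invEnum τ q θ θ c = invEnum τ q Y (τ X) c := by
    intro θ h1 h2
    rw [invEnum_congr_left θ hc0 (e' := Y), invEnum_congr_right Y hc0 (o' := τ X)]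
    · intro x hx
      rw [inner_of_eq_false τ (hc x hx)]
      exact ⟨(hXmax x hx).trans_lt h1, (hXmax x hx).trans_lt (hlt X)⟩
    · intro x hx
      exact ⟨h2.trans_le (hτ.monotone (hYmin x hx)), (hYmin x hx).trans_lt (hlt _)⟩
  have hcard : ∀ θ, X < θ → θ < τ Y → crossings τ θ c = c.card := fun θ h1 h2 =>
    crossings_eq_card fun x hx =>
      ⟨hc x hx, (hXmax x hx).trans_lt h1, h2.trans_le (hτ.monotone (hYmin x hx))⟩
  have hcX := filter_ne_add_replicate c (X, false)
  have hcY := filter_ne_add_replicate c (Y, false)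
  have hmX : c.count (X, false) ≠ 0 := (Multiset.count_pos.mpr hXc).ne'
  have hmY : c.count (Y, false) ≠ 0 := (Multiset.count_pos.mpr hYc).ne'
  have hA : ∀ x ∈ c.filter (fun y => y ≠ (X, false)), x.2 = false ∧ x.1 < X := by
    intro x hx
    rw [Multiset.mem_filter] at hx
    refine ⟨hc x hx.1, lt_of_le_of_ne (hXmax x hx.1) fun h => hx.2 (Prod.ext h (hc x hx.1))⟩
  have hB : ∀ x ∈ c.filter (fun y => y ≠ (Y, false)), x.2 = false ∧ Y < x.1 := by
    intro x hx
    rw [Multiset.mem_filter] at hx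
    refine ⟨hc x hx.1, lt_of_le_of_ne (hYmin x hx.1) fun h => hx.2 (Prod.ext h.symm (hc x hx.1))⟩
  set A := c.filter (fun y => y ≠ (X, false))
  set B := c.filter (fun y => y ≠ (Y, false))
  set mX := c.count (X, false)
  set mY := c.count (Y, false)
  have hZX : ∀ e o, e ≤ X → invEnum τ q e o c =
      hcomp q (crossings τ X A + if X < o then 1 else 0) mX * invEnum τ q e o A := by
    intro e o h
    rw [← hcX]
    exact invEnum_add_max hlt h A hA o mX
  have hZY : ∀ e o, τ Y ≤ o → invEnum τ q e o c =
      hcomp q (crossings τ (τ Y) B + if e < τ Y then 1 else 0) mY * invEnum τ q e o B := by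
    intro e o h
    rw [← hcY]
    exact invEnum_add_min hτ hlt B hB h mY
  have hcc : c.card ≠ 0 := by simpa using hc0
  have hgen : ∀ e o, (∀ x ∈ c, e ≤ x.1 ∧ τ x.1 ≤ o) →
      invEnum τ q e o c = invEnum τ q Y (τ X) c := by
    intro e o h
    rw [invEnum_congr_left o hc0 (e' := Y), invEnum_congr_right Y hc0 (o' := τ X)]
    · intro x hx
      rw [inner_of_eq_false τ (hc x hx)]
      exact ⟨(hlt _).trans_le (h x hx).2, (hXmax x hx).trans_lt (hlt X)⟩
    · intro x hx
      exact ⟨(h x hx).1.trans_lt (hlt _), (hYmin x hx).trans_lt (hlt _)⟩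
  have hcrX : ∀ θ, θ ≤ X → crossings τ θ c = crossings τ θ A := by
    intro θ h
    rw [← hcX, crossings_add, crossings_replicate, if_neg fun h' => h'.2.1.not_ge h, add_zero]
  have hcrY : ∀ θ, τ Y ≤ θ → crossings τ θ c = crossings τ θ B := by
    intro θ h
    rw [← hcY, crossings_add, crossings_replicate, if_neg fun h' => h'.2.2.not_ge h, add_zero]
  -- Stripping `X` settles `θ ≤ X`, stripping `Y` settles `τ Y ≤ θ`. If `τ Y ≤ X`, these ranges
  -- overlap; otherwise they are joined through the gap between `X` and `τ Y`, where the bounds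
  -- impose nothing and every letter crosses `θ`.
  rcases (hYmin _ hXc).eq_or_lt with hXY | hXY
  · obtain rfl : Y = X := hXY
    have hA0 : A = 0 := Multiset.eq_zero_of_forall_notMem fun x hx =>
      ((hA x hx).2.trans_le (hYmin x (Multiset.mem_of_mem_filter hx))).false
    have hZ : invEnum τ q Y (τ Y) c = 1 := by
      rw [hZX Y _ le_rfl, hA0, invEnum_zero, if_pos (hlt Y), if_pos (hlt Y)]
      simp [crossings, hcomp_one]
    have hne := hq _ hcc
    obtain ⟨m, hm⟩ := Nat.exists_eq_succ_of_ne_zero hmX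
    refine ⟨(1 - q ^ c.card)⁻¹, fun θ => ?_, fun e o h _ => ?_⟩
    · rcases le_or_gt θ Y with h1 | h1
      · rw [hZX θ θ h1, if_neg h1.not_gt, hcrX θ h1, hA0, hm]
        simp [crossings]
      · rcases lt_or_ge θ (τ Y) with h2 | h2
        · rw [hmid θ h1 h2, hZ, hcard θ h1 h2, mul_inv_cancel₀ hne]
        · have hB0 : B = 0 := hA0
          have hm' : mY = m + 1 := hm
          rw [hZY θ θ h2, if_neg h2.not_gt, hcrY θ h2, hB0, hm']
          simp [crossings]
    · rw [hgen e o h, hZ, mul_inv_cancel₀ hne]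
  have hYA : (Y, false) ∈ A := Multiset.mem_filter.mpr ⟨hYc, fun h => hXY.ne (congrArg Prod.fst h)⟩
  have hXB : (X, false) ∈ B := Multiset.mem_filter.mpr ⟨hXc, fun h => hXY.ne' (congrArg Prod.fst h)⟩
  have hAc : A < c := filter_ne_lt hXc
  have hBc : B < c := filter_ne_lt hYc
  obtain ⟨κA, hκA, hκA'⟩ := IH A hAc (fun x hx => (hA x hx).1) (fun h => by simp [h] at hYA)
  obtain ⟨κB, hκB, hκB'⟩ := IH B hBc (fun x hx => (hB x hx).1) (fun h => by simp [h] at hXB)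
  have hF1 : ∀ θ, θ ≤ X → invEnum τ q θ θ c =
      (1 - q ^ crossings τ θ c) * (hcomp q (crossings τ X A) mX * κA) := by
    intro θ h
    rw [hZX θ θ h, if_neg h.not_gt, hκA, hcrX θ h, add_zero]
    ring
  have hF2 : ∀ θ, τ Y ≤ θ → invEnum τ q θ θ c =
      (1 - q ^ crossings τ θ c) * (hcomp q (crossings τ (τ Y) B) mY * κB) := by
    intro θ h
    rw [hZY θ θ h, if_neg h.not_gt, hκB, hcrY θ h, add_zero]
    ring
  rcases le_or_gt (τ Y) X with h1 | h1
  -- Compare both formulas at `θ = τ Y` or `θ = X`, wherever a crossing makes the prefactor nonzero.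
  -- If neither has one, both `hcomp` have no variables and positive degree, so they vanish.
  · have hK : hcomp q (crossings τ X A) mX * κA = hcomp q (crossings τ (τ Y) B) mY * κB := by
      rcases eq_or_ne (crossings τ (τ Y) c) 0 with h2 | h2
      · rcases eq_or_ne (crossings τ X c) 0 with h3 | h3
        · rw [← hcrX X le_rfl, ← hcrY _ le_rfl, h2, h3]
          obtain ⟨m, hm⟩ := Nat.exists_eq_succ_of_ne_zero hmX
          obtain ⟨m', hm'⟩ := Nat.exists_eq_succ_of_ne_zero hmY
          simp [hm, hm']
        · exact mul_left_cancel₀ (hq _ h3) ((hF1 X le_rfl).symm.trans (hF2 X h1))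
      · exact mul_left_cancel₀ (hq _ h2) ((hF1 _ h1).symm.trans (hF2 _ le_rfl))
    refine ⟨hcomp q (crossings τ X A) mX * κA, fun θ => ?_,
      fun e o _ h => absurd (h _ hXc _ hYc) h1.not_gt⟩
    rcases le_or_gt θ X with h2 | h2
    · exact hF1 θ h2
    · rw [hK]
      exact hF2 θ (h1.trans h2.le)
  · have hcompat : ∀ x ∈ c, ∀ y ∈ c, x.1 < τ y.1 := fun x hx y hy =>
      ((hXmax x hx).trans_lt h1).trans_le (hτ.monotone (hYmin y hy))
    have hAle : ∀ x ∈ A, x ∈ c := fun x hx => Multiset.mem_of_mem_filter hx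
    have hBle : ∀ x ∈ B, x ∈ c := fun x hx => Multiset.mem_of_mem_filter hx
    have hcA : c.card = A.card + mX := by
      rw [← hcX, Multiset.card_add, Multiset.card_replicate]
    have hcB : c.card = B.card + mY := by
      rw [← hcY, Multiset.card_add, Multiset.card_replicate]
    -- Here all letters of `A` cross `X` and the front is a slot too, so the factor has `A.card + 1`
    -- variables; `one_sub_pow_mul_hcomp` then replaces `A.card` by `c.card` in the prefactor.
    have hG1 : invEnum τ q Y (τ X) c =
        (1 - q ^ c.card) * (hcomp q (crossings τ X A) mX * κA) := by
      rw [hZX _ _ hXY.le, if_pos (hlt X), hκA' Y (τ X)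
        (fun x hx => ⟨hYmin x (hAle x hx), hτ.monotone (hXmax x (hAle x hx))⟩)
        (fun x hx y hy => hcompat x (hAle x hx) y (hAle y hy)),
        crossings_eq_card (fun x hx => ⟨(hA x hx).1, (hA x hx).2, hcompat _ hXc x (hAle x hx)⟩)]
      have := one_sub_pow_mul_hcomp q A.card mX
      rw [← hcA] at this
      linear_combination κA * this
    have hG2 : invEnum τ q Y (τ X) c =
        (1 - q ^ c.card) * (hcomp q (crossings τ (τ Y) B) mY * κB) := by
      rw [hZY _ _ (hτ.monotone hXY.le), if_pos (hlt Y), hκB' Y (τ X)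
        (fun x hx => ⟨hYmin x (hBle x hx), hτ.monotone (hXmax x (hBle x hx))⟩)
        (fun x hx y hy => hcompat x (hBle x hx) y (hBle y hy)),
        crossings_eq_card (fun x hx => ⟨(hB x hx).1, hcompat x (hBle x hx) _ hYc, hτ (hB x hx).2⟩)]
      have := one_sub_pow_mul_hcomp q B.card mY
      rw [← hcB] at this
      linear_combination κB * this
    have hK := mul_left_cancel₀ (hq _ hcc) (hG1.symm.trans hG2)
    refine ⟨hcomp q (crossings τ X A) mX * κA, fun θ => ?_, fun e o h _ => (hgen e o h).trans hG1⟩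
    rcases le_or_gt θ X with h2 | h2
    · exact hF1 θ h2
    · rcases lt_or_ge θ (τ Y) with h3 | h3
      · rw [hmid θ h2 h3, hcard θ h2 h3]
        exact hG1
      · rw [hK]
        exact hF2 θ h3

/-- The enumerator with equal bounds `θ` depends on `θ` only through the number of crossings and
the decorated letters at and above `θ`. -/
theorem exists_invEnum (hτ : StrictMono τ) (hlt : ∀ x, x < τ x) (hq0 : q ≠ 0)
    (hq : ∀ n : ℕ, n ≠ 0 → 1 - q ^ n ≠ 0) (c : Multiset (T × Bool)) :
    ∃ κ : K, ∀ θ, invEnum τ q θ θ c =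
      q ^ c.countP (fun x => x.2 = true ∧ θ ≤ τ x.1) *
        (1 - q ^ ((crossings τ θ c : ℤ) - c.countP (fun x => x.2 = true ∧ τ x.1 = θ))) * κ := by
  induction c using Multiset.strongInductionOn with
  | ih c IH =>
  by_cases hund : ∀ x ∈ c, x.2 = false
  · rcases eq_or_ne c 0 with rfl | hc0
    · exact ⟨0, fun θ => by simp [invEnum_zero]⟩
    · obtain ⟨κ, hκ, -⟩ := exists_invEnum_undecorated hτ hlt hq c hund hc0
      refine ⟨κ, fun θ => ?_⟩
      rw [hκ θ, Multiset.countP_eq_zero.mpr (fun x hx h => by simp [hund x hx] at h),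
        Multiset.countP_eq_zero.mpr (fun x hx h => by simp [hund x hx] at h)]
      simp
  · push Not at hund
    obtain ⟨⟨X, b⟩, hXc, hb⟩ := hund
    obtain rfl : b = true := by simpa using hb
    have hcX := filter_ne_add_replicate c (X, true)
    have hX : (X, true) ∉ c.filter (fun y => y ≠ (X, true)) := by simp
    have hAc : c.filter (fun y => y ≠ (X, true)) < c := filter_ne_lt hXc
    have hm : c.count (X, true) ≠ 0 := (Multiset.count_pos.mpr hXc).ne'
    set A := c.filter (fun y => y ≠ (X, true))
    set m := c.count (X, true)
    obtain ⟨κ, hκ⟩ := IH A hAc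
    refine ⟨elem q (crossings τ (τ X) A) m * κ, fun θ => ?_⟩
    have hcr : crossings τ θ c = crossings τ θ A := by
      rw [← hcX, crossings_add, crossings_replicate]
      simp
    rw [hcr]
    rw [← hcX, invEnum_add_decorated hτ hlt A hX, hκ θ, Multiset.countP_add, Multiset.countP_add,
      countP_replicate, countP_replicate]
    simp only [true_and]
    rcases lt_trichotomy (τ X) θ with h | rfl | h
    · simp only [decFactor, h, h.le, h.ne, h.not_ge, if_true, if_false, add_zero]
      ring1
    -- At `θ = τ X` there is one slot fewer than for other `θ`; `one_sub_pow_mul_elem` restores it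
    -- and lowers the exponent in the prefactor by `m`.
    · have h0 : A.countP (fun x => x.2 = true ∧ τ x.1 = τ X) = 0 := by
        refine Multiset.countP_eq_zero.mpr fun x hx h => hX ?_
        rw [← hτ.injective h.2, ← h.1]
        exact hx
      simp only [decFactor, lt_irrefl, le_refl, if_true, if_false, h0, Nat.cast_zero, sub_zero,
        zero_add, pow_add, zpow_natCast]
      rcases crossings τ (τ X) A with _ | h
      · obtain ⟨m', hm'⟩ := Nat.exists_eq_succ_of_ne_zero hm
        simp [hm']
      · have := one_sub_pow_mul_elem hq0 h m
        rw [Nat.add_sub_cancel]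
        linear_combination q ^ m * q ^ A.countP (fun x => x.2 = true ∧ τ X ≤ τ x.1) * κ * this
    · simp only [decFactor, h.not_gt, h.not_ge, h.le, h.ne', if_true, if_false, add_zero, pow_add]
      ring1

end Rotation

/-! ### Step words and their sequences of levels. -/

section Words

/-- The level reached by a word that starts on level `d`. -/
def endLevel (d : ℤ) (p : List Step) : ℤ := d + p.count Step.north - p.count Step.east

@[simp] theorem endLevel_nil (d : ℤ) : endLevel d [] = d := by simp [endLevel]

@[simp] theorem endLevel_north (d : ℤ) (p : List Step) :
    endLevel d (Step.north :: p) = endLevel (d + 1) p := by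
  simp [endLevel]
  ring

@[simp] theorem endLevel_east (d : ℤ) (p : List Step) :
    endLevel d (Step.east :: p) = endLevel (d - 1) p := by
  simp [endLevel]
  ring

theorem northDiagonals_append (d : ℤ) (u v : List Step) :
    northDiagonals d (u ++ v) = northDiagonals d u ++ northDiagonals (endLevel d u) v := by
  induction u generalizing d with
  | nil => simp [northDiagonals]
  | cons s u ih => cases s <;> simp [northDiagonals, ih]

/-- The head `d - 1` acts as an imaginary earlier row: it encodes that the first north step starts
at most on level `d`. -/
theorem isChain_northDiagonals (d : ℤ) (p : List Step) :
    ((d - 1) :: northDiagonals d p).IsChain (fun a b => b ≤ a + 1) := by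
  induction p generalizing d with
  | nil => simp [northDiagonals]
  | cons s p ih =>
    cases s with
    | north =>
      have := ih (d + 1)
      rw [add_sub_cancel_right] at this
      simpa [northDiagonals] using this
    | east =>
      have := ih (d - 1)
      rw [northDiagonals]
      cases h : northDiagonals (d - 1) p with
      | nil => simp
      | cons b l =>
        rw [h, List.isChain_cons_cons] at this
        exact List.isChain_cons_cons.mpr ⟨by linarith [this.1], this.2⟩

theorem northDiagonals_eq_nil {p : List Step} {d : ℤ} (h : northDiagonals d p = []) :
    endLevel d p = d - p.length ∧ p.getLast? ≠ some Step.north := by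
  induction p generalizing d with
  | nil => simp
  | cons s p ih =>
    cases s with
    | north => simp [northDiagonals] at h
    | east =>
      obtain ⟨h1, h2⟩ := ih h
      refine ⟨by rw [endLevel_east, h1]; push_cast [List.length_cons]; ring, ?_⟩
      cases p with
      | nil => simp
      | cons s p => rwa [List.getLast?_cons_cons]

/-- The last north step is followed by at least one east step, and only by east steps, down to level
`0`. -/
theorem getLast?_northDiagonals_nonneg {p : List Step} {d : ℤ} (hp : p.getLast? ≠ some Step.north)
    (hd : endLevel d p = 0) : ∀ b ∈ (northDiagonals d p).getLast?, 0 ≤ b := by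
  induction p generalizing d with
  | nil => simp [northDiagonals]
  | cons s p ih =>
    cases s with
    | north =>
      rw [endLevel_north] at hd
      have hp0 : p ≠ [] := by
        rintro rfl
        simp at hp
      have hp' : p.getLast? ≠ some Step.north := by
        cases p with
        | nil => exact absurd rfl hp0
        | cons s p => rwa [List.getLast?_cons_cons] at hp
      rw [northDiagonals]
      cases h : northDiagonals (d + 1) p with
      | nil =>
        have h1 := (northDiagonals_eq_nil h).1
        have h2 := List.length_pos_of_ne_nil hp0
        simp only [List.getLast?_singleton, Option.mem_def, Option.some.injEq, forall_eq']
        omega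
      | cons b l =>
        rw [List.getLast?_cons_cons, ← h]
        exact ih hp' hd
    | east =>
      rw [endLevel_east] at hd
      rw [northDiagonals]
      cases p with
      | nil => simp [northDiagonals]
      | cons s p => exact ih (by rwa [List.getLast?_cons_cons] at hp) hd

/-- To return to level `0` the word must rise, and its first north step starts at or below `h`.
Hence the shift can be read off the area word. -/
theorem exists_northDiagonals_le {v : List Step} {h : ℤ} (h0 : h < 0) (hv : endLevel h v = 0) :
    ∃ b ∈ northDiagonals h v, b ≤ h := by
  induction v generalizing h with
  | nil => simp at hv; omega
  | cons s v ih =>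
    cases s with
    | north => exact ⟨h, by simp [northDiagonals], le_rfl⟩
    | east =>
      obtain ⟨b, hb, hbh⟩ := ih (h := h - 1) (by omega) (by simpa using hv)
      exact ⟨b, hb, by omega⟩

theorem exists_endLevel_take {p : List Step} {d b : ℤ} (hb : b ∈ northDiagonals d p) :
    ∃ l < p.length + 1, b = endLevel d (p.take l) := by
  induction p generalizing d with
  | nil => simp [northDiagonals] at hb
  | cons s p ih =>
    cases s with
    | north =>
      rw [northDiagonals, List.mem_cons] at hb
      rcases hb with rfl | hb
      · exact ⟨0, by simp, by simp⟩
      · obtain ⟨l, hl, h⟩ := ih hb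
        exact ⟨l + 1, by simpa using hl, by simpa using h⟩
    | east =>
      obtain ⟨l, hl, h⟩ := ih hb
      exact ⟨l + 1, by simpa using hl, by simpa using h⟩

/-- The word from level `d` to level `0` whose north steps start on the given levels. -/
def pathWord : ℤ → List ℤ → List Step
  | d, [] => List.replicate d.toNat Step.east
  | d, b :: l => List.replicate (d - b).toNat Step.east ++ Step.north :: pathWord (b + 1) l

theorem northDiagonals_replicate (d : ℤ) (n : ℕ) :
    northDiagonals d (List.replicate n Step.east) = [] := by
  induction n generalizing d with
  | zero => rfl
  | succ n ih => exact ih _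

theorem endLevel_replicate (d : ℤ) (n : ℕ) :
    endLevel d (List.replicate n Step.east) = d - n := by
  simp [endLevel, List.count_replicate]

theorem endLevel_append (d : ℤ) (u v : List Step) :
    endLevel d (u ++ v) = endLevel (endLevel d u) v := by
  simp [endLevel]
  ring

theorem northDiagonals_pathWord {d : ℤ} {l : List ℤ}
    (h : ((d - 1) :: l).IsChain (fun a b => b ≤ a + 1)) : northDiagonals d (pathWord d l) = l := by
  induction l generalizing d with
  | nil => exact northDiagonals_replicate _ _
  | cons b l ih =>
    rw [List.isChain_cons_cons] at h
    have h1 : endLevel d (List.replicate (d - b).toNat Step.east) = b := by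
      rw [endLevel_replicate]
      omega
    rw [pathWord, northDiagonals_append, northDiagonals_replicate, h1, List.nil_append,
      northDiagonals, ih (by simpa using h.2)]

theorem endLevel_pathWord {d : ℤ} {l : List ℤ}
    (h : ((d - 1) :: l).IsChain (fun a b => b ≤ a + 1))
    (h0 : ∀ b ∈ ((d - 1) :: l).getLast?, -1 ≤ b) : endLevel d (pathWord d l) = 0 := by
  induction l generalizing d with
  | nil =>
    simp at h0
    rw [pathWord, endLevel_replicate]
    omega
  | cons b l ih =>
    rw [List.isChain_cons_cons] at h
    have h1 : endLevel d (List.replicate (d - b).toNat Step.east) = b := by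
      rw [endLevel_replicate]
      omega
    rw [List.getLast?_cons_cons] at h0
    rw [pathWord, endLevel_append, h1, endLevel_north]
    exact ih (by simpa using h.2) (by simpa using h0)

theorem getLast?_pathWord (d : ℤ) {l : List ℤ} (h0 : ∀ b ∈ l.getLast?, 0 ≤ b) :
    (pathWord d l).getLast? ≠ some Step.north := by
  induction l generalizing d with
  | nil => simp [pathWord, List.getLast?_replicate]
  | cons b l ih =>
    rw [pathWord, List.getLast?_append_cons]
    cases l with
    | nil =>
      have hb : 0 ≤ b := by simpa using h0
      obtain ⟨n, hn⟩ : ∃ n, (b + 1).toNat = n + 1 := ⟨b.toNat, by omega⟩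
      rw [pathWord, hn, List.replicate_succ, List.getLast?_cons_cons, ← List.replicate_succ]
      simp [List.getLast?_replicate]
    | cons b' l =>
      rw [List.getLast?_cons_cons] at h0
      have := ih (b + 1) h0
      cases h : pathWord (b + 1) (b' :: l) with
      | nil => simp [pathWord] at h
      | cons s p => rwa [List.getLast?_cons_cons, ← h]

theorem pathWord_northDiagonals {d : ℤ} {p : List Step} (h : endLevel d p = 0) :
    pathWord d (northDiagonals d p) = p := by
  induction p generalizing d with
  | nil =>
    obtain rfl : d = 0 := by simpa using h
    rfl
  | cons s p ih =>
    cases s with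
    | north => simp [northDiagonals, pathWord, ih (by simpa using h)]
    | east =>
      rw [endLevel_east] at h
      have h1 := isChain_northDiagonals (d - 1) p
      have h2 := ih h
      rw [northDiagonals]
      cases hl : northDiagonals (d - 1) p with
      | nil =>
        have h3 := (northDiagonals_eq_nil hl).1
        obtain ⟨n, rfl⟩ : ∃ n : ℕ, d = n + 1 := ⟨p.length, by omega⟩
        rw [hl, pathWord] at h2
        rw [pathWord, ← h2]
        simp [← List.replicate_succ]
      | cons b l =>
        rw [hl, List.isChain_cons_cons] at h1
        obtain ⟨n, hn⟩ : ∃ n : ℕ, d - 1 - b = n := ⟨(d - 1 - b).toNat, by omega⟩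
        have hn' : d - b = (n + 1 : ℕ) := by push_cast; omega
        rw [hl, pathWord, hn, Int.toNat_natCast] at h2
        rw [pathWord, hn', Int.toNat_natCast, List.replicate_succ, List.cons_append, h2]

end Words

/-! ### Square paths characterised by their area words. -/

namespace SquarePath

variable {N : ℕ} (π : SquarePath N)

theorem endLevel_word : endLevel 0 π.word = 0 := by
  simp [endLevel, π.count_north, π.count_east]

theorem ofFn_a : List.ofFn π.a = northDiagonals 0 π.word := by
  refine List.ext_getElem ?_ fun i _ _ => ?_
  · rw [List.length_ofFn, length_northDiagonals, π.count_north]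
  · simp [a]

theorem a_injective {π σ : SquarePath N} (h : π.a = σ.a) : π = σ := by
  refine SquarePath.ext ?_
  rw [← pathWord_northDiagonals π.endLevel_word, ← pathWord_northDiagonals σ.endLevel_word,
    ← ofFn_a, ← ofFn_a, h]

theorem neg_shift_le_a (i : Fin N) : -(π.shift : ℤ) ≤ π.a i := by
  have hi : π.a i ∈ northDiagonals 0 π.word := by
    rw [← ofFn_a]
    simp
  obtain ⟨l, hl, h⟩ := exists_endLevel_take hi
  have := Finset.le_sup (f := fun l =>
    (π.word.take l).count Step.east - (π.word.take l).count Step.north)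
    (Finset.mem_range.mpr hl)
  change _ ≤ π.shift at this
  rw [endLevel] at h
  omega

theorem shift_le {s : ℕ} (h : ∀ i, -(s : ℤ) ≤ π.a i) : π.shift ≤ s := by
  refine Finset.sup_le fun l _ => ?_
  by_contra hs
  have h1 : endLevel 0 (π.word.take l) < -s := by
    rw [endLevel]
    omega
  have h2 := π.endLevel_word
  rw [← List.take_append_drop l π.word, endLevel_append] at h2
  obtain ⟨b, hb, hb'⟩ := exists_northDiagonals_le (by omega) h2
  have h3 : b ∈ List.ofFn π.a := by
    rw [ofFn_a, ← List.take_append_drop l π.word, northDiagonals_append]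
    exact List.mem_append_right _ hb
  obtain ⟨i, rfl⟩ := (List.mem_ofFn' _ _).mp h3
  have := h i
  omega

theorem shift_eq {s : ℕ} (h : ∀ i, -(s : ℤ) ≤ π.a i) (h' : ∃ i, π.a i = -(s : ℤ)) :
    π.shift = s := by
  obtain ⟨i, hi⟩ := h'
  have h1 := π.shift_le h
  have h2 := π.neg_shift_le_a i
  omega

theorem a_succ_le {i j : Fin N} (hij : i.val + 1 = j.val) : π.a j ≤ π.a i + 1 := by
  have h := isChain_northDiagonals 0 π.word
  rw [← ofFn_a] at h
  have h := List.isChain_iff_getElem.mp h (i.val + 1) (by simp; omega)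
  have hj : j = ⟨i.val + 1, hij ▸ j.isLt⟩ := Fin.ext hij.symm
  rw [hj]
  simpa using h

theorem a_zero_le {i : Fin N} (hi : i.val = 0) : π.a i ≤ 0 := by
  have h := isChain_northDiagonals 0 π.word
  rw [← ofFn_a] at h
  have h := List.isChain_iff_getElem.mp h 0 (by simp; omega)
  have hi' : i = ⟨0, hi ▸ i.isLt⟩ := Fin.ext hi
  rw [hi']
  simpa using h

theorem a_last_nonneg {i : Fin N} (hi : i.val + 1 = N) : 0 ≤ π.a i := by
  refine getLast?_northDiagonals_nonneg π.ends_east π.endLevel_word _ ?_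
  rw [← ofFn_a, List.getLast?_eq_getElem?]
  have : N - 1 = i.val := by omega
  simp [this]

/-- A sequence of levels that starts at most on level `0`, ends at least on level `0` and rises by
at most one in each step is the area word of a square path. -/
theorem exists_a_eq (f : Fin N → ℤ) (h0 : ∀ i : Fin N, i.val = 0 → f i ≤ 0)
    (h1 : ∀ i j : Fin N, i.val + 1 = j.val → f j ≤ f i + 1)
    (h2 : ∀ i : Fin N, i.val + 1 = N → 0 ≤ f i) : ∃ π : SquarePath N, π.a = f := by
  have hlast : ∀ b ∈ (List.ofFn f).getLast?, 0 ≤ b := by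
    rw [List.getLast?_eq_getElem?]
    intro b hb
    rw [Option.mem_def, List.getElem?_eq_some_iff] at hb
    obtain ⟨h, rfl⟩ := hb
    rw [List.length_ofFn] at h
    rw [List.getElem_ofFn]
    exact h2 _ (by simp only [List.length_ofFn]; omega)
  have hchain : (((0 : ℤ) - 1) :: List.ofFn f).IsChain (fun a b => b ≤ a + 1) := by
    rw [List.isChain_iff_getElem]
    rintro (_ | i) hi
    · simpa using h0 ⟨0, by simpa using hi⟩ rfl
    · simpa using h1 ⟨i, by simp at hi; omega⟩ ⟨i + 1, by simpa using hi⟩ rfl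
  have hnd := northDiagonals_pathWord hchain
  have hend : endLevel 0 (pathWord 0 (List.ofFn f)) = 0 := by
    refine endLevel_pathWord hchain ?_
    rcases h : List.ofFn f with _ | ⟨b, l⟩
    · simp
    · rw [List.getLast?_cons_cons, ← h]
      exact fun b hb => (by norm_num : (-1 : ℤ) ≤ 0).trans (hlast b hb)
  have hN : (pathWord 0 (List.ofFn f)).count Step.north = N := by
    rw [← length_northDiagonals _ 0, hnd, List.length_ofFn]
  refine ⟨⟨pathWord 0 (List.ofFn f), hN, ?_, getLast?_pathWord 0 hlast⟩, ?_⟩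
  · rw [endLevel, hN] at hend
    omega
  · refine List.ofFn_injective ?_
    rw [ofFn_a, hnd]

end SquarePath

/-! ### Admissibility and inversions in terms of rows. -/

section OfFn

variable {T : Type*} [LinearOrder T] {τ : T → T} {N : ℕ}

theorem admissible_ofFn (e o : T) (f : Fin N → T × Bool) :
    Admissible τ e o (List.ofFn f) ↔ (N = 0 → e < o) ∧
      (∀ i : Fin N, i.val = 0 → inner τ (f i) < o) ∧
      (∀ i j : Fin N, i.val + 1 = j.val → inner τ (f j) < τ (f i).1) ∧
      ∀ i : Fin N, i.val + 1 = N → e < τ (f i).1 := by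
  induction N generalizing o with
  | zero => simp [Admissible]
  | succ N ih =>
    rw [List.ofFn_succ, Admissible, ih]
    constructor
    · rintro ⟨h1, h2, h3, h4, h5⟩
      refine ⟨by simp, ?_, ?_, ?_⟩
      · intro i hi
        obtain rfl : i = 0 := Fin.ext hi
        exact h1
      · intro i j hij
        obtain ⟨j, rfl⟩ := Fin.exists_succ_eq.mpr (show j ≠ 0 by rintro rfl; simp at hij)
        rw [Fin.val_succ, add_left_inj] at hij
        rcases Fin.eq_zero_or_eq_succ i with rfl | ⟨i, rfl⟩
        · exact h3 j hij.symm
        · exact h4 i j hij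
      · intro i hi
        rcases Fin.eq_zero_or_eq_succ i with rfl | ⟨i, rfl⟩
        · exact h2 (by simpa using hi.symm)
        · exact h5 i (by simpa using hi)
    · rintro ⟨-, h2, h3, h4⟩
      refine ⟨h2 0 rfl, ?_, ?_, ?_, ?_⟩
      · rintro rfl
        exact h4 0 rfl
      · intro i hi
        exact h3 0 i.succ (by simp [hi])
      · intro i j hij
        exact h3 i.succ j.succ (by simpa using hij)
      · intro i hi
        exact h4 i.succ (by simpa using hi)

theorem countP_map_univ {α : Type*} (p : α → Prop) [DecidablePred p] (f : Fin N → α) :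
    ((Finset.univ : Finset (Fin N)).val.map f).countP p =
      (Finset.univ.filter fun i => p (f i)).card := by
  rw [Multiset.countP_map]
  rfl

theorem inversions_ofFn (f : Fin N → T × Bool) :
    inversions τ (List.ofFn f) = (Finset.univ.filter fun p : Fin N × Fin N =>
      p.1 < p.2 ∧ (f p.1).2 = false ∧ (f p.2).1 < (f p.1).1 ∧ (f p.1).1 < τ (f p.2).1).card := by
  rw [Finset.card_filter, Fintype.sum_prod_type]
  induction N with
  | zero => simp [inversions]
  | succ N ih =>
    rw [List.ofFn_succ, inversions, Fin.sum_univ_succ, ih]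
    congr 1
    · rw [Fin.sum_univ_succ, ← Fin.univ_val_map, invFrom, countP_map_univ, Finset.card_filter]
      rcases h : (f 0).2 with _ | _ <;> simp [h]
    · refine Finset.sum_congr rfl fun i _ => ?_
      rw [Fin.sum_univ_succ]
      simp

end OfFn

/-! ### The order on levels and labels. -/

/-- The pairs of a level and a label, ordered by increasing level and then decreasing label. -/
abbrev Value : Type := ℤ ×ₗ ℕᵒᵈ

namespace Value

/-- The value with the given level and label. -/
def mk (l : ℤ) (w : ℕ) : Value := toLex (l, OrderDual.toDual w)

/-- The level of a value. -/
def level (v : Value) : ℤ := (ofLex v).1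

/-- The label of a value. -/
def label (v : Value) : ℕ := OrderDual.ofDual (ofLex v).2

@[simp] theorem level_mk (l : ℤ) (w : ℕ) : (mk l w).level = l := rfl

@[simp] theorem label_mk (l : ℤ) (w : ℕ) : (mk l w).label = w := rfl

@[simp] theorem mk_level_label (v : Value) : mk v.level v.label = v := rfl

theorem lt_iff {v v' : Value} :
    v < v' ↔ v.level < v'.level ∨ v.level = v'.level ∧ v'.label < v.label :=
  Prod.Lex.lt_iff

theorem eq_iff {v v' : Value} : v = v' ↔ v.level = v'.level ∧ v.label = v'.label := by
  constructor
  · rintro rfl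
    exact ⟨rfl, rfl⟩
  · rintro ⟨h1, h2⟩
    rw [← mk_level_label v, ← mk_level_label v', h1, h2]

/-- The value one level higher. -/
def raise (v : Value) : Value := mk (v.level + 1) v.label

@[simp] theorem level_raise (v : Value) : v.raise.level = v.level + 1 := rfl

@[simp] theorem label_raise (v : Value) : v.raise.label = v.label := rfl

theorem strictMono_raise : StrictMono raise := fun v v' h => by
  rw [lt_iff] at h ⊢
  simpa using h

theorem lt_raise (v : Value) : v < v.raise := by
  rw [lt_iff]
  simp

end Value

/-! ### Decorated paths as admissible words. -/

namespace DecoratedPath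

variable {N : ℕ}

/-- The letter of a row: its level above the bottom diagonal, its label and its decoration. -/
def letter (π : DecoratedPath N) (i : Fin N) : Value × Bool :=
  (Value.mk (π.a i + π.shift) (π.label i), decide (i ∈ π.dv))

/-- The multiset of the letters of all rows. -/
def content (π : DecoratedPath N) : Multiset (Value × Bool) := Finset.univ.val.map π.letter

theorem coe_ofFn_letter (π : DecoratedPath N) :
    (List.ofFn π.letter : Multiset (Value × Bool)) = π.content :=
  (Fin.univ_val_map _).symm

theorem card_content (π : DecoratedPath N) : π.content.card = N := by simp [content]

/-- Between consecutive rows, admissibility is column strictness for an undecorated letter and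
contractibility for a decorated one. The first bound encodes `first_pos` or contractibility of the
first row, the last one that the final row has `a ≥ 0`. The empty word fails between equal bounds,
hence `hN`. -/
theorem admissible_letter (π : DecoratedPath N) (hN : 0 < N) :
    Admissible Value.raise (Value.mk π.shift 0) (Value.mk π.shift 0) (List.ofFn π.letter) := by
  rw [admissible_ofFn]
  refine ⟨by omega, ?_, ?_, ?_⟩
  · intro i hi
    have h1 := π.a_zero_le hi
    by_cases hd : i ∈ π.dv
    · rcases π.dv_valley i hd with ⟨-, h2⟩ | ⟨j, hj, -⟩
      · simp only [letter, hd, decide_true, inner_true, Value.lt_iff, Value.level_raise,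
          Value.label_raise, Value.level_mk, Value.label_mk]
        omega
      · omega
    · have h2 := π.first_pos i hi
      simp only [letter, hd, decide_false, inner_false, Value.lt_iff, Value.level_mk,
        Value.label_mk]
      rcases h1.lt_or_eq with h3 | h3
      · omega
      · have := h2 h3
        omega
  · intro i j hij
    have h1 := π.a_succ_le hij
    by_cases hd : j ∈ π.dv
    · rcases π.dv_valley j hd with ⟨h2, -⟩ | ⟨i', hi', h2⟩
      · omega
      · obtain rfl : i' = i := Fin.ext (by omega)
        simp only [letter, hd, decide_true, inner_true, Value.lt_iff, Value.level_raise,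
          Value.label_raise, Value.level_mk, Value.label_mk]
        omega
    · have h2 := π.column_strict i j hij
      simp only [letter, hd, decide_false, inner_false, Value.lt_iff, Value.level_raise,
        Value.label_raise, Value.level_mk, Value.label_mk]
      rcases h1.lt_or_eq with h3 | h3
      · omega
      · have := h2 (by omega)
        omega
  · intro i hi
    have h1 := π.a_last_nonneg hi
    simp only [letter, Value.lt_iff, Value.level_raise, Value.label_raise, Value.level_mk,
      Value.label_mk]
    omega

/-- Subtracting `s` from the levels gives the area word. The shift is indeed `s` because level `0`
occurs and no level is negative. -/
theorem exists_letter_eq (s : ℕ) (f : Fin N → Value × Bool)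
    (hf : Admissible Value.raise (Value.mk s 0) (Value.mk s 0) (List.ofFn f))
    (hlevel : ∀ i, 0 ≤ (f i).1.level) (hbot : ∃ i, (f i).1.level = 0 ∧ 0 < (f i).1.label) :
    ∃ π : DecoratedPath N, π.shift = s ∧ π.letter = f := by
  obtain ⟨-, h1, h2, h3⟩ := (admissible_ofFn _ _ _).mp hf
  have hin : ∀ i, (f i).1.level ≤ (inner Value.raise (f i)).level ∧
      (inner Value.raise (f i)).label = (f i).1.label ∧
      ((f i).2 = true → (inner Value.raise (f i)).level = (f i).1.level + 1) ∧
      ((f i).2 = false → (inner Value.raise (f i)).level = (f i).1.level) := by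
    intro i
    rw [inner]
    split_ifs with h <;> simp [h]
  simp only [Value.lt_iff, Value.level_raise, Value.label_raise, Value.level_mk,
    Value.label_mk] at h1 h2 h3
  obtain ⟨σ, hσ⟩ := SquarePath.exists_a_eq (fun i => (f i).1.level - s)
    (fun i hi => by have := h1 i hi; have := (hin i).1; omega)
    (fun i j hij => by have := h2 i j hij; have := (hin j).1; omega)
    (fun i hi => by have := h3 i hi; omega)
  have ha : ∀ i, σ.a i = (f i).1.level - s := fun i => congrFun hσ i
  have hs : σ.shift = s := by
    refine σ.shift_eq (fun i => ?_) ?_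
    · rw [ha]
      linarith [hlevel i]
    · obtain ⟨i, hi, -⟩ := hbot
      exact ⟨i, by rw [ha]; omega⟩
  let ρ : LabelledSquarePath N :=
    { toSquarePath := σ
      label := fun i => (f i).1.label
      column_strict := by
        intro i j hij hlt
        rw [ha, ha] at hlt
        have h4 := h2 i j hij
        obtain ⟨h5, h6, -⟩ := hin j
        omega
      first_pos := by
        intro i hi h0
        rw [ha] at h0
        have h4 := h1 i hi
        obtain ⟨h5, h6, -⟩ := hin i
        omega
      bottom_pos := by
        intro _
        obtain ⟨i, hi, hi'⟩ := hbot
        exact ⟨i, by rw [ha, hs]; omega, hi'⟩ }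
  have hρa : ∀ i, ρ.a i = (f i).1.level - s := ha
  refine ⟨{ toLabelledSquarePath := ρ
            dv := Finset.univ.filter fun i => (f i).2 = true
            dv_valley := ?_ }, hs, ?_⟩
  · intro i hi
    rw [Finset.mem_filter] at hi
    obtain ⟨-, h6, h7, -⟩ := hin i
    have h7 := h7 hi.2
    rw [LabelledSquarePath.IsContractibleValley]
    simp only [hρa]
    rcases Nat.eq_zero_or_pos i.val with h0 | h0
    · left
      have h4 := h1 i h0
      refine ⟨h0, ?_⟩
      change _ ∨ _ ∧ 0 < (f i).1.label
      omega
    · right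
      refine ⟨⟨i.val - 1, by omega⟩, by simp; omega, ?_⟩
      have h4 := h2 ⟨i.val - 1, by omega⟩ i (by simp; omega)
      change _ ∨ _ ∧ (f _).1.label < (f i).1.label
      omega
  · funext i
    refine Prod.ext (Value.eq_iff.mpr ⟨?_, rfl⟩) ?_
    · change σ.a i + (σ.shift : ℤ) = _
      rw [ha, hs]
      ring
    · change decide (i ∈ Finset.univ.filter fun i => (f i).2 = true) = (f i).2
      simp

theorem ext_letter {π σ : DecoratedPath N} (hs : π.shift = σ.shift) (h : π.letter = σ.letter) :
    π = σ := by
  have h' : ∀ i, π.a i + π.shift = σ.a i + σ.shift ∧ π.label i = σ.label i ∧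
      (i ∈ π.dv ↔ i ∈ σ.dv) := by
    intro i
    have h1 := congrFun h i
    simp only [letter, Prod.mk.injEq, Value.eq_iff, Value.level_mk, Value.label_mk,
      decide_eq_decide] at h1
    exact ⟨h1.1.1, h1.1.2, h1.2⟩
  have h1 : π.toSquarePath = σ.toSquarePath := by
    refine SquarePath.a_injective (funext fun i => ?_)
    have := (h' i).1
    rw [hs] at this
    exact add_right_cancel this
  exact DecoratedPath.ext (congrArg SquarePath.word h1) (funext fun i => (h' i).2.1)
    (Finset.ext fun i => (h' i).2.2)

theorem card_pos_eq (π : DecoratedPath N) : (Finset.univ.filter fun i => 0 < π.label i).card =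
    π.content.countP fun x => 0 < x.1.label := by
  rw [content, countP_map_univ]
  rfl

theorem card_dv_eq (π : DecoratedPath N) : π.dv.card = π.content.countP fun x => x.2 = true := by
  rw [content, countP_map_univ]
  congr 1
  ext i
  simp [letter]

theorem bottomCount_eq (π : DecoratedPath N) : π.bottomCount =
    π.content.countP fun x => x.2 = false ∧ x.1.level = 0 ∧ 0 < x.1.label := by
  rw [content, countP_map_univ, bottomCount]
  congr 1
  ext i
  simp [letter, eq_neg_iff_add_eq_zero]

theorem exponent_eq (π : DecoratedPath N) : π.exponent =
    ((π.content.filter fun x => 0 < x.1.label).map fun x => Finsupp.single x.1.label 1).sum := by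
  rw [content, Multiset.filter_map, Multiset.map_map]
  rfl

theorem area_eq (π : DecoratedPath N) : π.area = (π.content.map fun x => x.1.level).sum := by
  rw [content, Multiset.map_map]
  rfl

/-- The condition `u.1 < x.1 < τ u.1` unites primary inversions (equal levels) and secondary ones
(levels differing by one). -/
theorem dinv_eq (π : DecoratedPath N) : π.dinv =
    (inversions Value.raise (List.ofFn π.letter) : ℤ) +
      (π.content.countP fun x => x.1.level < (π.shift : ℤ) ∧ 0 < x.1.label : ℕ) -
      (π.content.countP fun x => x.2 = true : ℕ) := by
  rw [dinv, card_dv_eq, inversions_ofFn, content,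
    countP_map_univ fun x : Value × Bool => x.1.level < (π.shift : ℤ) ∧ 0 < x.1.label]
  refine congrArg₂ _ (congrArg₂ _ (congrArg _ (congrArg _ (Finset.ext fun p => ?_)))
    (congrArg _ (congrArg _ (Finset.ext fun i => ?_)))) rfl
  · classical
    rw [Finset.mem_filter, Finset.mem_filter]
    simp only [Finset.mem_univ, true_and, IsInversion, letter, Value.lt_iff,
      Value.level_mk, Value.label_mk, Value.level_raise, Value.label_raise, decide_eq_false_iff_not]
    constructor
    · rintro ⟨⟨h1, h2⟩, h3⟩
      exact ⟨h1, h3, by omega, by omega⟩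
    · rintro ⟨h1, h3, h4, h5⟩
      exact ⟨⟨h1, by omega⟩, h3⟩
  · simp [letter]

theorem level_nonneg (π : DecoratedPath N) : ∀ x ∈ π.content, 0 ≤ x.1.level := by
  intro x hx
  obtain ⟨i, -, rfl⟩ := Multiset.mem_map.mp hx
  have := π.neg_shift_le_a i
  simp only [letter, Value.level_mk]
  omega

end DecoratedPath

/-! ### The balance and the telescoping form. -/

section Telescope

/-- The number of undecorated positive letters below level `s`, minus the number of decorated
zeros below level `s - 1`. -/
def balance (c : Multiset (Value × Bool)) (s : ℤ) : ℤ :=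
  (c.countP fun x => x.2 = false ∧ 0 < x.1.label ∧ x.1.level < s : ℕ) -
    (c.countP fun x => x.2 = true ∧ x.1.label = 0 ∧ x.1.level + 1 < s : ℕ)

/-- The letters crossing `(s, 0)` are the undecorated positive ones on level `s`; those raised
exactly to `(s, 0)` are zeros on level `s - 1`. -/
theorem balance_succ (c : Multiset (Value × Bool)) (s : ℤ) :
    balance c (s + 1) = balance c s + ((crossings Value.raise (Value.mk s 0) c : ℤ) -
      (c.countP fun x => x.2 = true ∧ x.1.raise = Value.mk s 0 : ℕ)) := by
  simp only [balance, crossings, Value.lt_iff, Value.eq_iff, Value.level_raise, Value.label_raise,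
    Value.level_mk, Value.label_mk]
  induction c using Multiset.induction_on with
  | empty => simp
  | cons x c ih =>
    obtain ⟨v, b⟩ := x
    simp only [Multiset.countP_cons]
    push_cast
    cases b
    · simp only [Bool.false_eq_true, false_and, if_false, true_and]
      split_ifs <;> omega
    · simp only [Bool.true_eq_false, false_and, if_false, true_and]
      split_ifs <;> omega

/-- Identifies the balance as the whole power of `q` in front: the one from `exists_invEnum` plus
the non-inversion part of dinv. -/
theorem balance_eq (c : Multiset (Value × Bool)) (s : ℤ) :
    balance c s = (c.countP fun x => x.2 = true ∧ Value.mk s 0 ≤ x.1.raise : ℕ) +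
      ((c.countP fun x => x.1.level < s ∧ 0 < x.1.label : ℕ) -
        (c.countP fun x => x.2 = true : ℕ)) := by
  simp only [balance, ← not_lt, Value.lt_iff, Value.level_raise, Value.label_raise,
    Value.level_mk, Value.label_mk]
  induction c using Multiset.induction_on with
  | empty => simp
  | cons x c ih =>
    obtain ⟨v, b⟩ := x
    simp only [Multiset.countP_cons]
    push_cast
    cases b
    · simp only [Bool.false_eq_true, false_and, if_false, true_and]
      split_ifs <;> omega
    · simp only [Bool.true_eq_false, false_and, if_false, true_and]
      split_ifs <;> omega

theorem balance_zero {c : Multiset (Value × Bool)} (hc : ∀ x ∈ c, 0 ≤ x.1.level) :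
    balance c 0 = 0 := by
  rw [balance, Multiset.countP_eq_zero.mpr, Multiset.countP_eq_zero.mpr]
  · rfl
  · intro x hx h
    have := hc x hx
    omega
  · intro x hx h
    have := hc x hx
    omega

theorem balance_one {c : Multiset (Value × Bool)} (hc : ∀ x ∈ c, 0 ≤ x.1.level) :
    balance c 1 = (c.countP fun x => x.2 = false ∧ x.1.level = 0 ∧ 0 < x.1.label : ℕ) := by
  have h0 : (c.countP fun x => x.2 = true ∧ x.1.label = 0 ∧ x.1.level + 1 < 1) = 0 := by
    refine Multiset.countP_eq_zero.mpr fun x hx h => ?_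
    have := hc x hx
    omega
  rw [balance, h0, Nat.cast_zero, sub_zero]
  congr 1
  refine Multiset.countP_congr rfl fun x hx => ?_
  have := hc x hx
  simp only [eq_iff_iff]
  constructor
  · rintro ⟨h1, h2, h3⟩
    exact ⟨h1, by omega, h2⟩
  · rintro ⟨h1, h2, h3⟩
    exact ⟨h1, h3, by omega⟩

/-- Once every level counts, decorated positive letters cancel from the right-hand side. -/
theorem balance_top {c : Multiset (Value × Bool)} {s : ℤ} (hc : ∀ x ∈ c, x.1.level + 1 < s) :
    balance c s = (c.countP fun x => 0 < x.1.label : ℕ) - (c.countP fun x => x.2 = true : ℕ) := by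
  rw [balance]
  induction c using Multiset.induction_on with
  | empty => simp
  | cons x c ih =>
    have h1 := hc x (Multiset.mem_cons_self _ _)
    have ih := ih fun y hy => hc y (Multiset.mem_cons_of_mem hy)
    obtain ⟨v, b⟩ := x
    replace h1 : v.level + 1 < s := h1
    simp only [Multiset.countP_cons]
    push_cast
    cases b
    · simp only [Bool.false_eq_true, false_and, if_false, true_and]
      split_ifs <;> omega
    · simp only [Bool.true_eq_false, false_and, if_false, true_and]
      split_ifs <;> omega

theorem exists_telescope {K : Type*} [Field K] {q : K} (hq0 : q ≠ 0)
    (hq : ∀ n : ℕ, n ≠ 0 → 1 - q ^ n ≠ 0) (c : Multiset (Value × Bool)) :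
    ∃ κ : K, ∀ s : ℤ,
      q ^ (((c.countP fun x => x.1.level < s ∧ 0 < x.1.label : ℕ) : ℤ) -
          (c.countP fun x => x.2 = true : ℕ)) *
        invEnum Value.raise q (Value.mk s 0) (Value.mk s 0) c =
      (q ^ balance c s - q ^ balance c (s + 1)) * κ := by
  obtain ⟨κ, hκ⟩ := exists_invEnum Value.strictMono_raise Value.lt_raise hq0 hq c
  refine ⟨κ, fun s => ?_⟩
  rw [hκ, balance_succ, balance_eq c s, zpow_add₀ hq0 (_ + _), zpow_add₀ hq0 (Nat.cast _),
    zpow_natCast]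
  ring

end Telescope

/-! ### The indeterminate `q` and quotients of `q`-integers. -/

theorem q_ne_zero : q ≠ 0 := by
  rw [q, Ne, FaithfulSMul.algebraMap_eq_zero_iff]
  exact MvPolynomial.X_ne_zero 0

theorem one_sub_q_pow_ne_zero (n : ℕ) (hn : n ≠ 0) : 1 - q ^ n ≠ 0 := by
  intro h
  have h1 : (MvPolynomial.X 0 : MvPolynomial (Fin 2) ℚ) ^ n = 1 := by
    refine FaithfulSMul.algebraMap_injective (MvPolynomial (Fin 2) ℚ) QT ?_
    rw [map_pow, map_one]
    exact (sub_eq_zero.mp h).symm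
  have h2 := congrArg (MvPolynomial.eval fun _ => (0 : ℚ)) h1
  simp [hn] at h2

theorem qInt_div_qInt (a : ℤ) {b : ℕ} (hb : b ≠ 0) :
    qInt a / qInt b = (1 - q ^ a) / (1 - q ^ b) := by
  have h1 : 1 - q ≠ 0 := by simpa using one_sub_q_pow_ne_zero 1 one_ne_zero
  have h2 := one_sub_q_pow_ne_zero b hb
  rw [qInt, qInt, zpow_natCast]
  field_simp

/-! ### Summation over contents and shifts. -/

section Enumeration

variable {m n k r : ℕ}

/-- A positive `bottomCount` already supplies the undecorated positive label on the bottom diagonal.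
-/
theorem mem_LSQ'Touching (hr : 0 < r) {π : DecoratedPath (m + n)} :
    π ∈ LSQ'Touching m n k r ↔
      (Finset.univ.filter fun i => 0 < π.label i).card = n ∧ π.dv.card = k ∧ π.bottomCount = r := by
  constructor
  · rintro ⟨⟨⟨h1, h2⟩, -⟩, h3⟩
    exact ⟨h1, h2, h3⟩
  · rintro ⟨h1, h2, h3⟩
    refine ⟨⟨⟨h1, h2⟩, ?_⟩, h3⟩
    rw [← h3, DecoratedPath.bottomCount, Finset.card_pos] at hr
    obtain ⟨i, hi⟩ := hr
    rw [Finset.mem_filter] at hi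
    exact ⟨i, hi.2.2.1, hi.2.1, hi.2.2.2⟩

theorem mem_LDTouching (hr : 0 < r) {π : DecoratedPath (m + n)} :
    π ∈ LDTouching m n k r ↔ π ∈ LSQ'Touching m n k r ∧ π.shift = 0 := by
  rw [mem_LSQ'Touching hr]
  constructor
  · rintro ⟨⟨⟨h1, h2⟩, h3⟩, h4⟩
    exact ⟨⟨h1, h2, h4⟩, h3⟩
  · rintro ⟨⟨h1, h2, h4⟩, h3⟩
    exact ⟨⟨⟨h1, h2⟩, h3⟩, h4⟩

open Classical in
/-- The paths of a given content and shift, enumerated by their words of letters. -/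
theorem sum_content_shift (hr : 0 < r) (P : Finset (DecoratedPath (m + n))) (μ : ℕ →₀ ℕ)
    (hP : ∀ π, π ∈ P ↔ π.exponent = μ ∧ π ∈ LSQ'Touching m n k r)
    {c : Multiset (Value × Bool)} (hc : ∃ π ∈ P, π.content = c) (s : ℕ) :
    ∑ π ∈ P with π.content = c ∧ π.shift = s, q ^ π.dinv * t ^ π.area =
      t ^ (c.map fun x => x.1.level).sum *
        (q ^ (((c.countP fun x => x.1.level < (s : ℤ) ∧ 0 < x.1.label : ℕ) : ℤ) -
          (c.countP fun x => x.2 = true : ℕ)) *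
        invEnum Value.raise q (Value.mk s 0) (Value.mk s 0) c) := by
  obtain ⟨π₀, hπ₀, rfl⟩ := hc
  have hπ₀' := (hP _).mp hπ₀
  rw [mem_LSQ'Touching hr] at hπ₀'
  obtain ⟨h1, h2, h3, h4⟩ := hπ₀'
  have hbot : ∃ i, (π₀.letter i).1.level = 0 ∧ 0 < (π₀.letter i).1.label := by
    rw [← h4, DecoratedPath.bottomCount, Finset.card_pos] at hr
    obtain ⟨i, hi⟩ := hr
    rw [Finset.mem_filter] at hi
    exact ⟨i, by simp [DecoratedPath.letter, hi.2.2.1], hi.2.2.2⟩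
  have hN : 0 < m + n := by
    obtain ⟨i, -⟩ := hbot
    exact Fin.pos i
  rw [invEnum, ← Finset.sum_filter, Finset.mul_sum, Finset.mul_sum]
  refine Finset.sum_bij (fun π _ => List.ofFn π.letter) ?_ ?_ ?_ ?_
  · intro π hπ
    rw [Finset.mem_filter] at hπ ⊢
    refine ⟨mem_arrangements.mpr ?_, ?_⟩
    · rw [π.coe_ofFn_letter, hπ.2.1]
    · rw [← hπ.2.2]
      exact π.admissible_letter hN
  · intro π hπ σ hσ h
    rw [Finset.mem_filter] at hπ hσ
    exact DecoratedPath.ext_letter (hπ.2.2.trans hσ.2.2.symm) (List.ofFn_injective h)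
  · intro w hw
    rw [Finset.mem_filter, mem_arrangements] at hw
    obtain ⟨hw, hadm⟩ := hw
    have hlen : w.length = m + n := by
      rw [← π₀.card_content, ← hw, Multiset.coe_card]
    obtain ⟨f, rfl⟩ : ∃ f : Fin (m + n) → Value × Bool, List.ofFn f = w :=
      ⟨fun i => w[i.val]'(by rw [hlen]; exact i.isLt), List.ext_getElem (by simp [hlen]) (by simp)⟩
    have hmem : ∀ x, x ∈ π₀.content ↔ ∃ i, f i = x := by
      intro x
      rw [← hw, Multiset.mem_coe, List.mem_ofFn']
      rfl
    obtain ⟨π, hs, rfl⟩ := DecoratedPath.exists_letter_eq s f hadm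
      (fun i => π₀.level_nonneg _ ((hmem _).mpr ⟨i, rfl⟩)) (by
        obtain ⟨i, hi⟩ := hbot
        obtain ⟨j, hj⟩ := (hmem (π₀.letter i)).mp
          (Multiset.mem_map_of_mem _ (Finset.mem_univ_val i))
        exact ⟨j, by rwa [hj]⟩)
    rw [π.coe_ofFn_letter] at hw
    refine ⟨π, ?_, rfl⟩
    rw [Finset.mem_filter, hP, mem_LSQ'Touching hr, π.exponent_eq, π.card_pos_eq, π.card_dv_eq,
      π.bottomCount_eq, hw, ← π₀.exponent_eq, ← π₀.card_pos_eq, ← π₀.card_dv_eq,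
      ← π₀.bottomCount_eq]
    exact ⟨⟨h1, h2, h3, h4⟩, rfl, hs⟩
  · intro π hπ
    rw [Finset.mem_filter] at hπ
    rw [π.dinv_eq, π.area_eq, hπ.2.1, hπ.2.2, add_sub_assoc, zpow_add₀ q_ne_zero, zpow_natCast]
    ring

theorem enumerator_LSQ'Touching (hr : 0 < r) : enumerator (LSQ'Touching m n k r) =
    (qInt ((n : ℤ) - (k : ℤ)) / qInt (r : ℤ)) • enumerator (LDTouching m n k r) := by
  classical
  funext μ
  change enumerator (LSQ'Touching m n k r) μ =
    qInt ((n : ℤ) - (k : ℤ)) / qInt (r : ℤ) * enumerator (LDTouching m n k r) μ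
  obtain ⟨P, hPdef⟩ : ∃ P : Finset (DecoratedPath (m + n)), P =
    (finite_exponent_eq (m + n) μ).toFinset.filter fun π => π ∈ LSQ'Touching m n k r := ⟨_, rfl⟩
  have hP : ∀ π, π ∈ P ↔ π.exponent = μ ∧ π ∈ LSQ'Touching m n k r := by
    intro π
    rw [hPdef, Finset.mem_filter, Set.Finite.mem_toFinset]
    rfl
  have h1 : enumerator (LSQ'Touching m n k r) μ = ∑ π ∈ P, q ^ π.dinv * t ^ π.area := by
    rw [hPdef]
    rfl
  have h2 : enumerator (LDTouching m n k r) μ =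
      ∑ π ∈ P with π.shift = 0, q ^ π.dinv * t ^ π.area := by
    refine Finset.sum_congr (Finset.ext fun π => ?_) fun _ _ => rfl
    rw [Finset.mem_filter, Finset.mem_filter, hP, mem_LDTouching hr, Set.Finite.mem_toFinset,
      and_assoc]
    rfl
  rw [h1, h2, ← Finset.sum_fiberwise_of_maps_to (s := P) (t := P.image DecoratedPath.content)
      (g := DecoratedPath.content) (fun π hπ => Finset.mem_image_of_mem _ hπ),
    ← Finset.sum_fiberwise_of_maps_to (s := P.filter fun π => π.shift = 0)
      (t := P.image DecoratedPath.content) (g := DecoratedPath.content)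
      (fun π hπ => Finset.mem_image_of_mem _ (Finset.mem_filter.mp hπ).1), Finset.mul_sum]
  refine Finset.sum_congr rfl fun c hc => ?_
  have hc' : ∃ π ∈ P, π.content = c := by simpa using hc
  obtain ⟨κ, hκ⟩ := exists_telescope q_ne_zero one_sub_q_pow_ne_zero c
  have hsum := fun s : ℕ => (sum_content_shift hr P μ hP hc' s).trans (by rw [hκ])
  -- `S` exceeds all shifts, so that the telescoping sum is complete, and all levels by more than
  -- one, so that the balance has reached its final value.
  obtain ⟨S, hS1, hS2⟩ : ∃ S : ℕ, (∀ π ∈ P, π.shift < S) ∧ ∀ x ∈ c, x.1.level + 1 < S := by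
    refine ⟨P.sup (fun π => π.shift) + c.toFinset.sup (fun x => x.1.level.toNat) + 2, ?_, ?_⟩
    · intro π hπ
      have := Finset.le_sup (f := fun π : DecoratedPath (m + n) => π.shift) hπ
      omega
    · intro x hx
      have := Finset.le_sup (f := fun x : Value × Bool => x.1.level.toNat)
        (Multiset.mem_toFinset.mpr hx)
      push_cast
      omega
  have hlevel : ∀ x ∈ c, 0 ≤ x.1.level := by
    obtain ⟨π, -, rfl⟩ := hc'
    exact π.level_nonneg
  have htop : balance c S = (n : ℤ) - k := by
    obtain ⟨π, hπ, rfl⟩ := hc'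
    obtain ⟨h3, h4, -⟩ := (mem_LSQ'Touching hr).mp ((hP π).mp hπ).2
    rw [balance_top hS2, ← π.card_pos_eq, ← π.card_dv_eq, h3, h4]
  have hone : balance c 1 = r := by
    obtain ⟨π, hπ, rfl⟩ := hc'
    obtain ⟨-, -, h5⟩ := (mem_LSQ'Touching hr).mp ((hP π).mp hπ).2
    rw [balance_one hlevel, ← π.bottomCount_eq, h5]
  have hL : ∑ π ∈ P with π.content = c, q ^ π.dinv * t ^ π.area =
      t ^ (c.map fun x => x.1.level).sum * ((1 - q ^ ((n : ℤ) - k)) * κ) := by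
    rw [← Finset.sum_fiberwise_of_maps_to (t := Finset.range S) (g := fun π => π.shift)
      (fun π hπ => Finset.mem_range.mpr (hS1 π (Finset.mem_filter.mp hπ).1))]
    simp only [Finset.filter_filter, hsum]
    rw [← Finset.mul_sum, ← Finset.sum_mul]
    have := Finset.sum_range_sub' (fun s : ℕ => q ^ balance c s) S
    push_cast at this
    rw [this, balance_zero hlevel, htop, zpow_zero]
  have hR : ∑ π ∈ P.filter (fun π => π.shift = 0) with π.content = c,
      q ^ π.dinv * t ^ π.area =
      t ^ (c.map fun x => x.1.level).sum * ((1 - q ^ r) * κ) := by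
    have := hsum 0
    rw [Nat.cast_zero, balance_zero hlevel, zero_add, hone, zpow_zero, zpow_natCast] at this
    rw [Finset.filter_filter, ← this]
    exact Finset.sum_congr (Finset.filter_congr fun π _ => and_comm) fun _ _ => rfl
  have hne := one_sub_q_pow_ne_zero r hr.ne'
  rw [hL, hR, qInt_div_qInt _ hr.ne']
  field_simp

end Enumeration

end SquarePaths

theorem mainTheorem4 (m n k r : ℕ) (hr : 0 < r) :
    SquarePaths.enumerator (SquarePaths.LSQ'Touching m n k r) =
      (SquarePaths.qInt ((n : ℤ) - (k : ℤ)) / SquarePaths.qInt (r : ℤ)) •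
        SquarePaths.enumerator (SquarePaths.LDTouching m n k r) := by
  exact SquarePaths.enumerator_LSQ'Touching hr
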